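/- **Theorem.** For all nonnegative integers $g, r, d$, the Brill–Noether rank $\Gamma \mapsto w^r_d(\Gamma)$ is an upper semicontinuous function on the moduli space of metric graphs of genus $g$. More generally, for every integer $k \ge 0$ it is upper semicontinuous on the moduli space $M_{g,k}$ of metric graphs of genus $g$ built from combinatorial graphs all of whose vertices have valence at least $k$ (so $k=0$ gives all compact connected metric graphs of genus $g$, and $k=3$ the moduli space of stable metric graphs of genus $g$). *Definitions.* Let $G$ be a finite connected graph (loops and multiple edges allowed) with edges $e_1,\dots,e_n$; its genus is its first Betti number. Let $\sigma^*_G \subset \mathbb{R}_{\ge 0}^n$ be the set of $\ell=(\ell_1,\dots,\ell_n)$ such that no subgraph of $G$ of positive first Betti number has all its edge lengths equal to $0$; for $\ell\in\sigma_G^*$, let $\Gamma_\ell$ be the metric graph, with its path metric, obtained from $G$ by giving $e_i$ length $\ell_i$ (edges of length $0$ are contracted). The points of $M_{g,k}$ are the isometry classes of the metric graphs $\Gamma_\ell$, for $\ell\in\sigma^*_G$ and $G$ of genus $g$ with all valences at least $k$ (a loop counts twice); its topology is the finest one for which all maps $\sigma^*_G\to M_{g,k}$, $\ell\mapsto[\Gamma_\ell]$,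 are continuous. A divisor on a compact connected metric graph $\Gamma$ is a finite $\mathbb{Z}$-linear combination of points of $\Gamma$, and its degree is the sum of its coefficients. It is effective if all its coefficients are nonnegative. It is principal if it equals $\sum_{v} \mathrm{ord}_v(f)\, v$ for some continuous piecewise linear function $f$ on $\Gamma$ with integer slopes, where $\mathrm{ord}_v(f)$ is the sum of the incoming slopes of $f$ at $v$; two divisors are equivalent if their difference is principal. The rank of a divisor $D$ is $-1$ if $D$ is not equivalent to an effective divisor, and otherwise it is the largest integer $s$ such that for every effective divisor $E$ of degree $s$ there is a divisor $D'$ equivalent to $D$ with $D'-E$ effective. If $\Gamma$ has a divisor of degree $d$ and rank at least $r$, then $w^r_d(\Gamma)$ is the largest integer $\rho$ such that for every effective divisor $E$ of degree $r+\rho$ there is a divisor $D$ of degree $d$ and rank at least $r$ with $D-E$ effective; otherwise $w^r_d(\Gamma)=-1$. -/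

import Mathlib

open Topology

/-! ## Divisors, ranks and Brill-Noether ranks on a metric space -/

namespace MetricGraph

section Divisors

variable {X : Type*} [MetricSpace X]

/-- The branches `φ 0, …, φ (n - 1)`, parametrized by arc length on `[0, ε]`, exhibit a neighbourhood
of `p` as a star: `n` segments of length `ε`, glued at `p`, with their path metric. The `φ i` are the
`n` tangent directions at `p`. (If `n = 0`, the point `p` is isolated.) -/
structure IsStarChart (p : X) (ε : ℝ) {n : ℕ} (φ : Fin n → ℝ → X) : Prop where
  pos : 0 < ε
  center : ∀ i, φ i 0 = p
  dist_eq : ∀ i j, ∀ s ∈ Set.Icc 0 ε, ∀ t ∈ Set.Icc 0 ε,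
    dist (φ i s) (φ j t) = if i = j then |s - t| else s + t
  covers : ∀ x, dist x p < ε → x = p ∨ ∃ i, ∃ t ∈ Set.Icc 0 ε, φ i t = x

/-- Near `p` the function `f` is linear with integer slopes along each of the tangent directions, and
the sum of its incoming slopes at `p` (the negatives of the outgoing slopes `m i`) is `k`. -/
def HasOrderAt (f : X → ℝ) (p : X) (k : ℤ) : Prop :=
  ∃ (n : ℕ) (ε : ℝ) (φ : Fin n → ℝ → X) (m : Fin n → ℤ), IsStarChart p ε φ ∧
    (∀ i, ∀ t ∈ Set.Icc 0 ε, f (φ i t) = f p + m i * t) ∧ k = - ∑ i, m i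

/-- `D` is the divisor of a piecewise linear function with integer slopes. (On a compact space, a
function that is linear with integer slopes on a star around each point has finitely many linear
pieces.) -/
def IsPrincipal (D : X →₀ ℤ) : Prop :=
  ∃ f : X → ℝ, ∀ p, HasOrderAt f p (D p)

/-- Two divisors are equivalent if their difference is principal. -/
def LinEquiv (D D' : X →₀ ℤ) : Prop := IsPrincipal (D - D')

/-- The degree of a divisor. -/
def deg {X : Type*} (D : X →₀ ℤ) : ℤ := D.sum fun _ a => a

/-- Effective divisors: all coefficients are nonnegative. -/
def Effective {X : Type*} (D : X →₀ ℤ) : Prop := ∀ p, 0 ≤ D p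

open Classical in
/-- The Baker-Norine rank of a divisor. -/
noncomputable def rank (D : X →₀ ℤ) : ℤ :=
  if ∃ D', LinEquiv D' D ∧ Effective D' then
    sSup {k : ℤ | ∀ E : X →₀ ℤ, Effective E → deg E = k →
      ∃ D', LinEquiv D' D ∧ Effective (D' - E)}
  else -1

variable (X) in
/-- The set of divisors whose class lies in the Brill-Noether locus `W^r_d`. -/
def brillNoetherLocus (r d : ℕ) : Set (X →₀ ℤ) := {D | deg D = d ∧ (r : ℤ) ≤ rank D}

open Classical in
variable (X) in
/-- The Brill-Noether rank `w^r_d`. -/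
noncomputable def brillNoetherRank (r d : ℕ) : ℤ :=
  if (brillNoetherLocus X r d).Nonempty then
    sSup {ρ : ℤ | ∀ E : X →₀ ℤ, Effective E → deg E = r + ρ →
      ∃ D ∈ brillNoetherLocus X r d, Effective (D - E)}
  else -1

end Divisors

/-! ### Invariance under isometries -/

section Isometry

variable {X Y : Type} [MetricSpace X] [MetricSpace Y]

/-- Transport of divisors along an isometry. -/
noncomputable def push (h : X ≃ᵢ Y) : (X →₀ ℤ) ≃+ (Y →₀ ℤ) := Finsupp.domCongr h.toEquiv

theorem push_apply (h : X ≃ᵢ Y) (D : X →₀ ℤ) (y : Y) : push h D y = D (h.symm y) := by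
  simp [push, Finsupp.domCongr, Finsupp.equivMapDomain_apply]

theorem push_symm_push (h : X ≃ᵢ Y) (D : X →₀ ℤ) : push h.symm (push h D) = D := by
  ext x; simp [push_apply]

theorem push_push_symm (h : X ≃ᵢ Y) (D : Y →₀ ℤ) : push h (push h.symm D) = D := by
  ext x; simp [push_apply]

theorem deg_push (h : X ≃ᵢ Y) (D : X →₀ ℤ) : deg (push h D) = deg D := by
  simp [deg, push, Finsupp.domCongr, Finsupp.equivMapDomain_eq_mapDomain,
    Finsupp.sum_mapDomain_index]

theorem Effective.push (h : X ≃ᵢ Y) {D : X →₀ ℤ} (hD : Effective D) :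
    Effective (push h D) := fun y => by
  rw [push_apply]; exact hD _

theorem IsPrincipal.push (h : X ≃ᵢ Y) {D : X →₀ ℤ} (hD : IsPrincipal D) :
    IsPrincipal (push h D) := by
  obtain ⟨f, hf⟩ := hD
  refine ⟨f ∘ h.symm, fun y => ?_⟩
  obtain ⟨n, ε, φ, m, hc, hm, hk⟩ := hf (h.symm y)
  refine ⟨n, ε, fun i t => h (φ i t), m, ⟨hc.pos, fun i => ?_, fun i j s hs t ht => ?_,
    fun x hx => ?_⟩, fun i t ht => ?_, ?_⟩
  · simp [hc.center]
  · rw [h.dist_eq]; exact hc.dist_eq i j s hs t ht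
  · rcases hc.covers (h.symm x) (by rwa [h.symm.dist_eq]) with h1 | ⟨i, t, ht, h1⟩
    · exact Or.inl (h.symm.injective h1)
    · exact Or.inr ⟨i, t, ht, by simp [h1]⟩
  · simpa using hm i t ht
  · rw [push_apply]; exact hk

theorem LinEquiv.push (h : X ≃ᵢ Y) {D D' : X →₀ ℤ} (hD : LinEquiv D D') :
    LinEquiv (push h D) (push h D') := by
  have := IsPrincipal.push h hD
  rwa [map_sub] at this

theorem exists_effective_push (h : X ≃ᵢ Y) {D : X →₀ ℤ}
    (hD : ∃ D', LinEquiv D' D ∧ Effective D') :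
    ∃ D', LinEquiv D' (push h D) ∧ Effective D' := by
  obtain ⟨D', h1, h2⟩ := hD
  exact ⟨_, h1.push h, h2.push h⟩

theorem rank_set_push (h : X ≃ᵢ Y) {D : X →₀ ℤ} {k : ℤ}
    (hD : ∀ E : X →₀ ℤ, Effective E → deg E = k → ∃ D', LinEquiv D' D ∧ Effective (D' - E)) :
    ∀ E : Y →₀ ℤ, Effective E → deg E = k →
      ∃ D', LinEquiv D' (push h D) ∧ Effective (D' - E) := by
  intro E hE hk
  obtain ⟨D', h1, h2⟩ := hD (push h.symm E) (hE.push h.symm) (by rw [deg_push, hk])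
  refine ⟨_, h1.push h, ?_⟩
  have := h2.push h
  rwa [map_sub, push_push_symm] at this

theorem rank_push (h : X ≃ᵢ Y) (D : X →₀ ℤ) : rank (push h D) = rank D := by
  have h1 : (∃ D', LinEquiv D' (push h D) ∧ Effective D') ↔
      ∃ D', LinEquiv D' D ∧ Effective D' :=
    ⟨fun H => by simpa [push_symm_push] using exists_effective_push h.symm H,
      exists_effective_push h⟩
  have h2 : {k : ℤ | ∀ E : Y →₀ ℤ, Effective E → deg E = k →
      ∃ D', LinEquiv D' (push h D) ∧ Effective (D' - E)} =
      {k : ℤ | ∀ E : X →₀ ℤ, Effective E → deg E = k →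
        ∃ D', LinEquiv D' D ∧ Effective (D' - E)} := by
    ext k
    refine ⟨fun H => ?_, rank_set_push h⟩
    have := rank_set_push h.symm H
    rwa [push_symm_push] at this
  unfold rank
  rw [h2]
  classical exact if_congr h1 rfl rfl

theorem push_mem_brillNoetherLocus (h : X ≃ᵢ Y) {r d : ℕ} {D : X →₀ ℤ}
    (hD : D ∈ brillNoetherLocus X r d) : push h D ∈ brillNoetherLocus Y r d := by
  refine ⟨?_, ?_⟩
  · rw [deg_push]; exact hD.1
  · rw [rank_push]; exact hD.2

theorem brillNoetherRank_set_push (h : X ≃ᵢ Y) {r d : ℕ} {ρ : ℤ}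
    (H : ∀ E : X →₀ ℤ, Effective E → deg E = r + ρ →
      ∃ D ∈ brillNoetherLocus X r d, Effective (D - E)) :
    ∀ E : Y →₀ ℤ, Effective E → deg E = r + ρ →
      ∃ D ∈ brillNoetherLocus Y r d, Effective (D - E) := by
  intro E hE hk
  obtain ⟨D, h1, h2⟩ := H (push h.symm E) (hE.push h.symm) (by rw [deg_push, hk])
  refine ⟨_, push_mem_brillNoetherLocus h h1, ?_⟩
  have := h2.push h
  rwa [map_sub, push_push_symm] at this

theorem brillNoetherRank_congr (h : X ≃ᵢ Y) (r d : ℕ) :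
    brillNoetherRank X r d = brillNoetherRank Y r d := by
  have h1 : (brillNoetherLocus X r d).Nonempty ↔ (brillNoetherLocus Y r d).Nonempty :=
    ⟨fun ⟨_, H⟩ => ⟨_, push_mem_brillNoetherLocus h H⟩,
      fun ⟨_, H⟩ => ⟨_, push_mem_brillNoetherLocus h.symm H⟩⟩
  have h2 : {ρ : ℤ | ∀ E : X →₀ ℤ, Effective E → deg E = r + ρ →
      ∃ D ∈ brillNoetherLocus X r d, Effective (D - E)} =
      {ρ : ℤ | ∀ E : Y →₀ ℤ, Effective E → deg E = r + ρ →
        ∃ D ∈ brillNoetherLocus Y r d, Effective (D - E)} := by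
    ext ρ
    exact ⟨brillNoetherRank_set_push h, brillNoetherRank_set_push h.symm⟩
  unfold brillNoetherRank
  rw [h2]
  classical exact if_congr h1 rfl rfl

end Isometry

/-! ## Combinatorial graphs, their metric realizations, and the moduli space -/

/-- A finite connected graph with labelled vertices and edges; loops and multiple edges are allowed,
and each edge carries an auxiliary orientation. -/
structure Graph where
  /-- number of vertices -/
  m : ℕ
  /-- number of edges -/
  n : ℕ
  /-- initial vertex of an edge -/
  src : Fin n → Fin m
  /-- final vertex of an edge -/
  tgt : Fin n → Fin m
  nonempty : 0 < m
  connected : ∀ u v, Relation.EqvGen (fun a b => ∃ e, src e = a ∧ tgt e = b) u v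

namespace Graph

variable (G : Graph)

/-- Valence of a vertex (a loop counts twice). -/
def valence (v : Fin G.m) : ℕ :=
  (Finset.univ.filter fun e => G.src e = v).card + (Finset.univ.filter fun e => G.tgt e = v).card

/-- The space of simplicial 1-cycles with support in the set `I` of edges. -/
def cycles (I : Set (Fin G.n)) : Submodule ℚ (Fin G.n → ℚ) where
  carrier := {c | (∀ e ∉ I, c e = 0) ∧ ∀ v,
    ∑ e, (if G.tgt e = v then c e else 0) = ∑ e, (if G.src e = v then c e else 0)}
  zero_mem' := by simp
  add_mem' := by
    rintro a b ⟨ha, ha'⟩ ⟨hb, hb'⟩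
    refine ⟨fun e he => by simp [ha e he, hb e he], fun v => ?_⟩
    have hs : ∀ P : Fin G.n → Prop, ∀ _ : DecidablePred P,
        ∑ e, (if P e then (a + b) e else 0) =
          ∑ e, (if P e then a e else 0) + ∑ e, (if P e then b e else 0) := by
      intro P _
      rw [← Finset.sum_add_distrib]
      exact Finset.sum_congr rfl fun e _ => by split_ifs <;> simp
    rw [hs, hs, ha', hb']
  smul_mem' := by
    rintro k a ⟨ha, ha'⟩
    refine ⟨fun e he => by simp [ha e he], fun v => ?_⟩
    have hs : ∀ P : Fin G.n → Prop, ∀ _ : DecidablePred P,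
        ∑ e, (if P e then (k • a) e else 0) = k * ∑ e, (if P e then a e else 0) := by
      intro P _
      rw [Finset.mul_sum]
      exact Finset.sum_congr rfl fun e _ => by split_ifs <;> simp
    rw [hs, hs, ha']

/-- The first Betti number of the subgraph formed by the edges in `I`. -/
noncomputable def betti (I : Set (Fin G.n)) : ℕ := Module.finrank ℚ (G.cycles I)

/-- The genus of `G`. -/
noncomputable def genus : ℕ := G.betti Set.univ

/-- The parameter space `σ*` of possibly degenerate metric realizations of `G` that have the same
genus as `G`: the vectors of nonnegative edge lengths such that no subgraph of positive genus is
contracted. -/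
def Cone : Type :=
  {l : Fin G.n → ℝ // (∀ e, 0 ≤ l e) ∧
    ∀ I : Set (Fin G.n), 0 < G.betti I → ¬ ∀ e ∈ I, l e = 0}

instance : TopologicalSpace G.Cone := instTopologicalSpaceSubtype

variable {G}

/-- Points of the realization before gluing: the vertices, and for each edge `e` the points
`edge e s`, where `s ∈ [0, 1]` is the coordinate proportional to arc length, so that `edge e s` lies at
distance `s * l e` from the initial vertex along `e`. -/
inductive Pre (G : Graph) (l : G.Cone) : Type
  | vert (v : Fin G.m) : Pre G l
  | edge (e : Fin G.n) (s : unitInterval) : Pre G l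

/-- `Path x y L`: the points `x` and `y` are joined by a path of length `L`, a concatenation of
segments of edges; the ends of each edge are glued to its end vertices. -/
inductive Path (l : G.Cone) : Pre G l → Pre G l → ℝ → Prop
  | refl (x) : Path l x x 0
  | src (e) : Path l (.edge e 0) (.vert (G.src e)) 0
  | tgt (e) : Path l (.edge e 1) (.vert (G.tgt e)) 0
  | seg (e) (s t : unitInterval) : Path l (.edge e s) (.edge e t) (l.1 e * |(s : ℝ) - t|)
  | symm {x y L} : Path l x y L → Path l y x L
  | trans {x y z L L'} : Path l x y L → Path l y z L' → Path l x z (L + L')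

theorem Path.nonneg {l : G.Cone} {x y : Pre G l} {L : ℝ} (h : Path l x y L) : 0 ≤ L := by
  induction h with
  | refl => exact le_rfl
  | src => exact le_rfl
  | tgt => exact le_rfl
  | seg e s t => exact mul_nonneg (l.2.1 e) (abs_nonneg _)
  | symm _ ih => exact ih
  | trans _ _ ih ih' => exact add_nonneg ih ih'

theorem Path.exists_vert (l : G.Cone) (u v : Fin G.m) : ∃ L, Path l (.vert u) (.vert v) L := by
  induction G.connected u v with
  | rel a b h =>
    obtain ⟨e, rfl, rfl⟩ := h
    exact ⟨_, ((Path.src e).symm.trans (Path.seg e 0 1)).trans (Path.tgt e)⟩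
  | refl a => exact ⟨_, Path.refl _⟩
  | symm a b _ ih => obtain ⟨L, h⟩ := ih; exact ⟨L, h.symm⟩
  | trans a b c _ _ ih ih' =>
    obtain ⟨L, h⟩ := ih; obtain ⟨L', h'⟩ := ih'; exact ⟨_, h.trans h'⟩

theorem Path.exists_to_vert (l : G.Cone) (x : Pre G l) : ∃ v L, Path l x (.vert v) L := by
  cases x with
  | vert v => exact ⟨v, _, Path.refl _⟩
  | edge e s => exact ⟨_, _, (Path.seg e s 0).trans (Path.src e)⟩

theorem Path.exists (l : G.Cone) (x y : Pre G l) : ∃ L, Path l x y L := by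
  obtain ⟨u, L, h⟩ := Path.exists_to_vert l x
  obtain ⟨v, L', h'⟩ := Path.exists_to_vert l y
  obtain ⟨L'', h''⟩ := Path.exists_vert l u v
  exact ⟨_, (h.trans h'').trans h'.symm⟩

/-- The path pseudometric: the infimum of the lengths of the paths between two points. -/
noncomputable instance (l : G.Cone) : PseudoMetricSpace (Pre G l) where
  dist x y := sInf {L | Path l x y L}
  dist_self x := le_antisymm (csInf_le ⟨0, fun _ h => h.nonneg⟩ (Path.refl x))
    (Real.sInf_nonneg fun _ h => h.nonneg)
  dist_comm x y := congrArg sInf (Set.ext fun _ => ⟨Path.symm, Path.symm⟩)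
  dist_triangle x y z := by
    refine le_of_forall_pos_le_add fun ε hε => ?_
    obtain ⟨L, h, hL⟩ := exists_lt_of_csInf_lt (s := {L | Path l x y L}) (Path.exists l x y)
      (lt_add_of_pos_right _ (half_pos hε))
    obtain ⟨L', h', hL'⟩ := exists_lt_of_csInf_lt (s := {L | Path l y z L}) (Path.exists l y z)
      (lt_add_of_pos_right _ (half_pos hε))
    have := csInf_le (s := {L | Path l x z L}) ⟨0, fun _ h => h.nonneg⟩ (h.trans h')
    linarith

/-- The metric graph `Γ_l`, in which the edge `e` of `G` has length `l e`. Points at distance zero are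
identified, which glues the edges to their end vertices and contracts the edges of length zero. -/
abbrev Realization (l : G.Cone) : Type := SeparationQuotient (Pre G l)

end Graph

/-- The disjoint union of the cones `σ*` of all the graphs of genus `g` in which all vertices have
valence at least `k`. -/
abbrev Cones (g k : ℕ) : Type :=
  Σ G : {G : Graph // G.genus = g ∧ ∀ v, k ≤ G.valence v}, G.1.Cone

/-- Two edge length vectors are identified if they define isometric metric graphs. -/
instance isometrySetoid (g k : ℕ) : Setoid (Cones g k) where
  r a b := Nonempty (Graph.Realization a.2 ≃ᵢ Graph.Realization b.2)
  iseqv := ⟨fun _ => ⟨IsometryEquiv.refl _⟩, fun ⟨h⟩ => ⟨h.symm⟩, fun ⟨h⟩ ⟨h'⟩ => ⟨h.trans h'⟩⟩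

/-- The moduli space of metric graphs of genus `g` that have a model in which all vertices have
valence at least `k`: its points are the isometry classes, and it carries the colimit topology, the
finest topology for which the maps from all the cones are continuous. For `k = 0` this is the space of
all compact connected metric graphs of genus `g`, for `k = 3` the space of the stable ones. -/
abbrev Moduli (g k : ℕ) : Type := Quotient (isometrySetoid g k)

/-- The function taking `Γ` to `w^r_d(Γ)`, on the moduli space. -/
noncomputable def moduliBrillNoetherRank (g k r d : ℕ) : Moduli g k → ℤ :=
  Quotient.lift (fun a : Cones g k => brillNoetherRank (Graph.Realization a.2) r d)
    fun _ _ ⟨h⟩ => brillNoetherRank_congr h r d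

end MetricGraph

/-! The moduli space is a quotient of the disjoint union of the cones, so it suffices that `{w^r_d ≥
c}` is closed in each cone. All realizations of `G` share one compact space of labels, `Model G`:
vertices, and points of edges in rescaled coordinates. Effective divisors of fixed degree thus have
limits along an ultrafilter, even when edges are contracted. Given labels of a divisor `E` at the
limit `l₀`, choose for nearby `l` divisors `D ≥ E` of rank at least `r`, written as tuples of
labels, and pass to the limit. The same compactness produces, for each effective divisor of degree
`r`, a limiting divisor that contains it (`mem_domination_brillNoetherLocus_of_tendsto`). What
remains is that linear equivalence is a closed condition.

This is `mem_principalDivisors_of_tendsto`. A piecewise linear function is encoded by its vertex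
values and an integral initial slope on every edge, contracted edges included (`IsPotential`). If
the slopes stay bounded, they converge, and so does the system of equations. If they do not, divide
them by their norm: the contribution of the divisor disappears, and the limit is a nonzero real flow
`y` with zero boundary for which `l₀ * y` is a coboundary. Pairing the two gives `∑ l₀ e * y e ^ 2 =
0`, so `y` is a cycle on contracted edges. This contradicts the definition of `σ*`, by which no
subgraph with cycles is contracted.

The rest matches the combinatorial notion of principal divisor with the intrinsic one on the metric
space (`isPrincipal_mapDomain_pt_iff`). Distances are bounded above by paths and below by Lipschitz
functions; this yields star charts and determines which labels give the same point. Different labels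
of a point are equivalent divisors, since an integral flow along contracted edges costs nothing. -/

namespace MetricGraph

open Filter

/-! ### Combinatorial description of principal divisors -/

namespace Graph

/-- The labels of the points of the realizations of `G`: vertices, and points of the edges. -/
abbrev Model (G : Graph) : Type := Fin G.m ⊕ Fin G.n × unitInterval

variable {G : Graph}

/-- The indicator function of an edge. -/
def onEdge (e : Fin G.n) : Model G → ℤ
  | .inl _ => 0
  | .inr (e', _) => if e' = e then 1 else 0

/-- The function that vanishes off the edge `e`, where it takes `u` to `max (t - u) 0`. -/
noncomputable def ramp (e : Fin G.n) (t : ℝ) : Model G → ℝ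
  | .inl _ => 0
  | .inr (e', u) => if e' = e then max (t - u) 0 else 0

/-- The indicator function of a vertex. -/
def onVertex (v : Fin G.m) : Model G → ℤ
  | .inl v' => if v' = v then 1 else 0
  | .inr _ => 0

theorem continuous_model {Y : Type*} [TopologicalSpace Y] {g : Model G → Y}
    (hg : ∀ e, Continuous fun u => g (.inr (e, u))) : Continuous g := by
  refine continuous_sumElim (f := fun v => g (.inl v)) (g := fun x => g (.inr x)) |>.2
    ⟨continuous_of_discreteTopology, ?_⟩ |>.congr ?_
  · exact continuous_prod_of_discrete_left.2 hg
  · rintro (v | x) <;> rfl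

/-- Edges, with their ends, are clopen in the space of labels. A point moving to an end of `e` keeps
a label on `e`, so the number of points on `e` passes to weak limits. -/
theorem continuous_onEdge (e : Fin G.n) : Continuous (onEdge e) :=
  continuous_model fun e' => by
    simp only [onEdge]
    exact continuous_const

theorem continuous_onVertex (v : Fin G.m) : Continuous (onVertex v) :=
  continuous_model fun e' => by
    simp only [onVertex]
    exact continuous_const

theorem continuous_ramp (e : Fin G.n) (t : ℝ) : Continuous (ramp e t) :=
  continuous_model fun e' => by
    simp only [ramp]
    split_ifs <;> fun_prop

/-- The sum of the values of a function over a divisor, with multiplicities. -/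
noncomputable abbrev total {X M : Type*} [AddCommGroup M] (g : X → M) : (X →₀ ℤ) →ₗ[ℤ] M :=
  Finsupp.linearCombination ℤ g

theorem total_intCast {X : Type*} (g : X → ℤ) (D : X →₀ ℤ) :
    total (fun x => (g x : ℝ)) D = (total g D : ℤ) := by
  simp [Finsupp.linearCombination_apply, Finsupp.sum]

/-- The boundary of the 1-chain that has the value `m e` at the end of `e` and the value `m' e` at
its start. -/
def boundary {A : Type*} [AddCommGroup A] (m m' : Fin G.n → A) (v : Fin G.m) : A :=
  ∑ e, (if G.tgt e = v then m e else 0) - ∑ e, (if G.src e = v then m' e else 0)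

theorem boundary_add {A : Type*} [AddCommGroup A] (a b a' b' : Fin G.n → A) :
    boundary (a + b) (a' + b') = boundary a a' + boundary b b' := by
  funext v
  have hs : ∀ (P : Fin G.n → Prop) (_ : DecidablePred P) (a b : Fin G.n → A),
      ∑ e, (if P e then (a + b) e else 0) =
        ∑ e, (if P e then a e else 0) + ∑ e, (if P e then b e else 0) := by
    intro P _ a b
    rw [← Finset.sum_add_distrib]
    exact Finset.sum_congr rfl fun e _ => by split_ifs <;> simp
  rw [Pi.add_apply]
  unfold boundary
  rw [hs, hs]
  abel

theorem boundary_neg {A : Type*} [AddCommGroup A] (a a' : Fin G.n → A) :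
    boundary (-a) (-a') = -boundary a a' := by
  have h0 : boundary (0 : Fin G.n → A) 0 = 0 := by funext v; simp [boundary]
  have := boundary_add (G := G) a (-a) a' (-a')
  rw [add_neg_cancel, add_neg_cancel, h0] at this
  exact (neg_eq_of_add_eq_zero_right this.symm).symm

/-- Boundary and coboundary are adjoint. -/
theorem sum_boundary_mul (y : Fin G.n → ℝ) (h : Fin G.m → ℝ) :
    ∑ v, boundary y y v * h v = ∑ e, y e * (h (G.tgt e) - h (G.src e)) := by
  simp only [boundary, sub_mul, Finset.sum_mul, mul_sub, Finset.sum_sub_distrib]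
  congr 1 <;>
  · rw [Finset.sum_comm]
    refine Finset.sum_congr rfl fun e _ => ?_
    simp [ite_mul]

/-- `IsPotential l D h m`: there is a piecewise linear function with integer slopes and divisor `D` on
the realization, with values `h` at the vertices and initial slopes `m`. (A point of `D` at an end of
an edge is regarded as an inner point.) -/
structure IsPotential (l : G.Cone) (D : Model G →₀ ℤ) (h : Fin G.m → ℝ) (m : Fin G.n → ℤ) :
    Prop where
  edge : ∀ e, h (G.tgt e) - h (G.src e) = l.1 e * (m e - total (ramp e 1) D)
  vert : ∀ v, total (onVertex v) D = boundary (fun e => m e - total (onEdge e) D) m v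

theorem IsPotential.add {l : G.Cone} {D D' : Model G →₀ ℤ} {h h' : Fin G.m → ℝ}
    {m m' : Fin G.n → ℤ} (H : IsPotential l D h m) (H' : IsPotential l D' h' m') :
    IsPotential l (D + D') (h + h') (m + m') := by
  refine ⟨fun e => ?_, fun v => ?_⟩
  · have h1 := H.edge e
    have h2 := H'.edge e
    simp only [Pi.add_apply, map_add, Int.cast_add]
    linear_combination h1 + h2
  · rw [map_add, H.vert, H'.vert, ← Pi.add_apply, ← boundary_add]
    congr 1
    funext e
    simp only [Pi.add_apply, map_add]
    ring

theorem IsPotential.neg {l : G.Cone} {D : Model G →₀ ℤ} {h : Fin G.m → ℝ}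
    {m : Fin G.n → ℤ} (H : IsPotential l D h m) : IsPotential l (-D) (-h) (-m) := by
  refine ⟨fun e => ?_, fun v => ?_⟩
  · have h1 := H.edge e
    simp only [Pi.neg_apply, map_neg, Int.cast_neg]
    linear_combination -h1
  · rw [map_neg, H.vert, ← Pi.neg_apply, ← boundary_neg]
    congr 1
    funext e
    simp only [Pi.neg_apply, map_neg]
    ring

/-- The divisors of the piecewise linear functions with integer slopes on the realization. -/
def principalDivisors (l : G.Cone) : AddSubgroup (Model G →₀ ℤ) where
  carrier := {D | ∃ h m, IsPotential l D h m}
  zero_mem' := ⟨0, 0, by simp, by simp [boundary]⟩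
  add_mem' := fun ⟨_, _, H⟩ ⟨_, _, H'⟩ => ⟨_, _, H.add H'⟩
  neg_mem' := fun ⟨_, _, H⟩ => ⟨_, _, H.neg⟩

theorem sum_onVertex_add_sum_onEdge (D : Model G →₀ ℤ) :
    ∑ v, total (onVertex v) D + ∑ e, total (onEdge e) D = deg D := by
  have h : ∀ D : Model G →₀ ℤ, deg D = total (fun _ => (1 : ℤ)) D := fun D => by
    simp [deg, Finsupp.linearCombination_apply]
  rw [h]
  induction D using Finsupp.induction_linear with
  | zero => simp
  | add D D' h h' => simp only [map_add, Finset.sum_add_distrib, ← h, ← h']; ring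
  | single x a =>
    rcases x with v' | ⟨e', u⟩ <;> simp [onVertex, onEdge]

/-- In the sum of the vertex conditions each slope `m e` occurs once at each end and cancels; what
is left is minus the part of `D` on the edges. -/
theorem deg_eq_zero_of_mem_principalDivisors {l : G.Cone} {D : Model G →₀ ℤ}
    (hD : D ∈ principalDivisors l) : deg D = 0 := by
  obtain ⟨h, m, H⟩ := hD
  rw [← sum_onVertex_add_sum_onEdge]
  simp only [H.vert]
  unfold boundary
  rw [Finset.sum_sub_distrib]
  rw [Finset.sum_comm, Finset.sum_comm (γ := Fin G.m)]
  simp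

/-! ### Closedness of linear equivalence -/

/-- A nonzero real cycle on contracted edges would give a nonzero rational one, hence a contracted
subgraph of positive Betti number. -/
theorem eq_zero_of_boundary_eq_zero {l : G.Cone} {y : Fin G.n → ℝ} (hy : boundary y y = 0)
    (hl : ∀ e, l.1 e ≠ 0 → y e = 0) : y = 0 := by
  by_contra hne
  obtain ⟨e₀, he₀⟩ := Function.ne_iff.1 hne
  -- Betti numbers are defined over `ℚ`; a `ℚ`-linear functional on `ℝ` turns the real cycle into a
  -- rational one without killing its value at `e₀`.
  obtain ⟨φ, hφ⟩ : ∃ φ : Module.Dual ℚ ℝ, φ (y e₀) ≠ 0 := by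
    by_contra! h
    exact he₀ ((Module.forall_dual_apply_eq_zero_iff ℚ _).1 h)
  refine l.2.2 {e | l.1 e = 0} ?_ fun e he => he
  have hc : (fun e => φ (y e)) ∈ G.cycles {e | l.1 e = 0} := by
    refine ⟨fun e he => by simp [hl e he], fun v => ?_⟩
    have h := congrArg φ (sub_eq_zero.1 (congrFun hy v))
    simpa only [map_sum, apply_ite φ, map_zero] using h
  have : Nontrivial (G.cycles {e | l.1 e = 0}) :=
    ⟨⟨⟨_, hc⟩, 0, fun h => hφ (congrFun (congrArg Subtype.val h) e₀)⟩⟩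
  exact Module.finrank_pos

variable (G) in
/-- The coboundary map. -/
def coboundary : (Fin G.m → ℝ) →ₗ[ℝ] (Fin G.n → ℝ) where
  toFun h e := h (G.tgt e) - h (G.src e)
  map_add' a b := by funext e; simp only [Pi.add_apply]; ring
  map_smul' a b := by funext e; simp [mul_sub]

theorem isClosed_range_coboundary : IsClosed (Set.range (coboundary G)) := by
  have := Submodule.closed_of_finiteDimensional (LinearMap.range (coboundary G))
  rwa [LinearMap.coe_range] at this

/-- A harmonic flow has energy `∑ l e * y e ^ 2 = 0` by adjointness, so it lives on the contracted
edges, which carry no cycles. -/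
theorem eq_zero_of_mul_mem_range {l : G.Cone} {y : Fin G.n → ℝ} (hy : boundary y y = 0)
    (hl : (fun e => l.1 e * y e) ∈ Set.range (coboundary G)) : y = 0 := by
  obtain ⟨h, hh⟩ := hl
  have h0 : ∑ e, y e * (h (G.tgt e) - h (G.src e)) = 0 := by
    rw [← sum_boundary_mul, hy]; simp
  have h1 : ∀ e, h (G.tgt e) - h (G.src e) = l.1 e * y e := fun e => congrFun hh e
  simp only [h1] at h0
  have hn : ∀ e ∈ Finset.univ, 0 ≤ y e * (l.1 e * y e) := fun e _ => by
    have := mul_nonneg (l.2.1 e) (mul_self_nonneg (y e)); linarith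
  refine eq_zero_of_boundary_eq_zero (l := l) hy fun e he => ?_
  have := (Finset.sum_eq_zero_iff_of_nonneg hn).1 h0 e (Finset.mem_univ e)
  simp only [mul_eq_zero, he, false_or, or_self] at this
  exact this

/-- Weak convergence of divisors. -/
def WeakTendsto {ι : Type*} (D : ι → Model G →₀ ℤ) (F : Filter ι) (D₀ : Model G →₀ ℤ) : Prop :=
  ∀ g : Model G → ℝ, Continuous g → Tendsto (fun i => total g (D i)) F (𝓝 (total g D₀))

theorem tendsto_boundary {ι : Type*} {F : Filter ι} {a b : ι → Fin G.n → ℝ} {a₀ b₀ : Fin G.n → ℝ}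
    (ha : ∀ e, Tendsto (fun i => a i e) F (𝓝 (a₀ e)))
    (hb : ∀ e, Tendsto (fun i => b i e) F (𝓝 (b₀ e))) (v : Fin G.m) :
    Tendsto (fun i => boundary (a i) (b i) v) F (𝓝 (boundary a₀ b₀ v)) := by
  refine (tendsto_finsetSum _ fun e _ => ?_).sub (tendsto_finsetSum _ fun e _ => ?_) <;>
  · split_ifs
    exacts [by first | exact ha e | exact hb e, tendsto_const_nhds]

theorem intCast_boundary (a b : Fin G.n → ℤ) (v : Fin G.m) :
    ((boundary a b v : ℤ) : ℝ) = boundary (fun e => (a e : ℝ)) (fun e => (b e : ℝ)) v := by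
  simp [boundary]

theorem boundary_smul (c : ℝ) (a b : Fin G.n → ℝ) (v : Fin G.m) :
    boundary (fun e => c * a e) (fun e => c * b e) v = c * boundary a b v := by
  simp only [boundary, mul_sub, Finset.mul_sum, mul_ite, mul_zero]

/-- The equations of a potential pass to the limit once the slopes are bounded, and unbounded slopes
would yield, after rescaling, a harmonic flow of norm one on the limit graph. -/
theorem mem_principalDivisors_of_tendsto {ι : Type*} (U : Ultrafilter ι) {l : ι → G.Cone}
    {l₀ : G.Cone} {D : ι → Model G →₀ ℤ} {D₀ : Model G →₀ ℤ} (hl : Tendsto l U (𝓝 l₀))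
    (hD : WeakTendsto D U D₀) (H : ∀ᶠ i in (U : Filter ι), D i ∈ principalDivisors (l i)) :
    D₀ ∈ principalDivisors l₀ := by
  obtain ⟨h, H⟩ := Eventually.choice H
  obtain ⟨m, H⟩ := Eventually.choice H
  have hle : ∀ e, Tendsto (fun i => (l i).1 e) U (𝓝 (l₀.1 e)) := fun e =>
    ((continuous_apply e).tendsto _).comp ((continuous_subtype_val.tendsto _).comp hl)
  have hW : ∀ e, Tendsto (fun i => total (ramp e 1) (D i)) U (𝓝 (total (ramp e 1) D₀)) := fun e =>
    hD _ (continuous_ramp e 1)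
  have hC : ∀ e, Tendsto (fun i => ((total (onEdge e) (D i) : ℤ) : ℝ)) U
      (𝓝 ((total (onEdge e) D₀ : ℤ) : ℝ)) := fun e => by
    simp only [← total_intCast]
    exact hD _ (continuous_of_discreteTopology.comp (continuous_onEdge e))
  have hV : ∀ v, Tendsto (fun i => ((total (onVertex v) (D i) : ℤ) : ℝ)) U
      (𝓝 ((total (onVertex v) D₀ : ℤ) : ℝ)) := fun v => by
    simp only [← total_intCast]
    exact hD _ (continuous_of_discreteTopology.comp (continuous_onVertex v))
  by_cases hb : ∃ C : ℝ, ∀ᶠ i in (U : Filter ι), ‖m i‖ ≤ C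
  · obtain ⟨C, hC'⟩ := hb
    obtain ⟨m₀, -, hm₀⟩ := (isCompact_closedBall (0 : Fin G.n → ℤ) C).ultrafilter_le_nhds
      (U.map m) (le_principal_iff.2 (Ultrafilter.mem_map.2 (by
        filter_upwards [hC'] with i hi
        simpa using hi)))
    have hm : ∀ e, Tendsto (fun i => ((m i e : ℤ) : ℝ)) U (𝓝 ((m₀ e : ℤ) : ℝ)) := fun e =>
      ((continuous_of_discreteTopology (f := fun z : ℤ => (z : ℝ))).tendsto _).comp
        (((continuous_apply e).tendsto _).comp hm₀)
    -- The vertex values need not converge, being free up to constants. Only their coboundaries do,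
    -- and the coboundaries form a closed subspace.
    obtain ⟨h₀, hh₀⟩ : (fun e => l₀.1 e * (m₀ e - total (ramp e 1) D₀)) ∈
        Set.range (coboundary G) := by
      refine isClosed_range_coboundary.mem_of_tendsto (b := (U : Filter ι))
        (f := fun i e => (l i).1 e * (m i e - total (ramp e 1) (D i))) ?_ ?_
      · exact tendsto_pi_nhds.2 fun e => (hle e).mul ((hm e).sub (hW e))
      · filter_upwards [H] with i hi
        exact ⟨h i, funext fun e => hi.edge e⟩
    refine ⟨h₀, m₀, fun e => congrFun hh₀ e, fun v => ?_⟩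
    have h1 := tendsto_boundary (a := fun i e => (m i e : ℝ) - (total (onEdge e) (D i) : ℤ))
      (fun e => (hm e).sub (hC e)) hm v
    have h2 := tendsto_nhds_unique_of_eventuallyEq (hV v) h1 (by
      filter_upwards [H] with i hi
      rw [hi.vert, intCast_boundary]
      push_cast
      rfl)
    have h3 := intCast_boundary (fun e => m₀ e - total (onEdge e) D₀) m₀ v
    push_cast at h3
    rw [← h3] at h2
    exact_mod_cast h2
  · exfalso
    have hN : Tendsto (fun i => ‖m i‖) U atTop := by
      refine tendsto_atTop.2 fun C => ?_
      have := Ultrafilter.eventually_not.2 fun h => hb ⟨C, h⟩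
      filter_upwards [this] with i hi using (not_le.1 hi).le
    have hinv := tendsto_inv_atTop_zero.comp hN
    set y : ι → Fin G.n → ℝ := fun i e => ‖m i‖⁻¹ * m i e with hy
    have hym : ∀ i, ‖y i‖ = ‖m i‖⁻¹ * ‖m i‖ := fun i => by
      have h1 : y i = ‖m i‖⁻¹ • (fun e => (m i e : ℝ)) := rfl
      have h2 : ‖(fun e => (m i e : ℝ))‖ = ‖m i‖ := by
        simp only [Pi.norm_def]
        congr 2
      rw [h1, norm_smul, h2, norm_inv, norm_norm]
    have hy1 : ∀ᶠ i in (U : Filter ι), ‖y i‖ = 1 := by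
      filter_upwards [hN.eventually_gt_atTop 0] with i hi
      rw [hym, inv_mul_cancel₀ hi.ne']
    obtain ⟨y₀, hy₀, hyy⟩ := (isCompact_sphere (0 : Fin G.n → ℝ) 1).ultrafilter_le_nhds
      (U.map y) (le_principal_iff.2 (Ultrafilter.mem_map.2 (by
        filter_upwards [hy1] with i hi
        simpa using hi)))
    have hye : ∀ e, Tendsto (fun i => y i e) U (𝓝 (y₀ e)) := fun e =>
      ((continuous_apply e).tendsto _).comp hyy
    have h0 : y₀ = 0 := by
      refine eq_zero_of_mul_mem_range (l := l₀) (funext fun v => ?_) ?_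
      -- The divisor terms stay bounded, so division by the norm of the slopes removes them from the
      -- vertex condition, and below from the edge condition.
      · have h1 := tendsto_boundary
          (a := fun i e => y i e - ‖m i‖⁻¹ * (total (onEdge e) (D i) : ℤ)) (b₀ := y₀)
          (fun e => (hye e).sub (hinv.mul (hC e))) hye v
        have h2 := tendsto_nhds_unique_of_eventuallyEq (hinv.mul (hV v)) h1 (by
          filter_upwards [H] with i hi
          rw [hi.vert, intCast_boundary]
          simp only [hy, ← mul_sub, boundary_smul, Function.comp]
          push_cast
          rfl)
        simp only [zero_mul, sub_zero] at h2
        exact h2.symm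
      · have h1 : Tendsto (fun i e => (l i).1 e * (y i e - ‖m i‖⁻¹ * total (ramp e 1) (D i))) U
            (𝓝 fun e => l₀.1 e * y₀ e) := tendsto_pi_nhds.2 fun e => by
          have := (hle e).mul ((hye e).sub (hinv.mul (hW e)))
          simpa using this
        refine isClosed_range_coboundary.mem_of_tendsto h1 ?_
        filter_upwards [H] with i hi
        refine ⟨‖m i‖⁻¹ • h i, ?_⟩
        rw [map_smul]
        funext e
        have := hi.edge e
        simp only [coboundary, LinearMap.coe_mk, AddHom.coe_mk, Pi.smul_apply, smul_eq_mul, this,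
          hy]
        ring
    rw [h0] at hy₀
    simp at hy₀

end Graph

/-! ### Effective divisors and ranks -/

section Rank

theorem deg_eq_total {X : Type*} (D : X →₀ ℤ) : deg D = Graph.total (fun _ => (1 : ℤ)) D := by
  simp [deg, Finsupp.linearCombination_apply]

theorem deg_add {X : Type*} (D D' : X →₀ ℤ) : deg (D + D') = deg D + deg D' := by
  simp only [deg_eq_total, map_add]

theorem deg_sub {X : Type*} (D D' : X →₀ ℤ) : deg (D - D') = deg D - deg D' := by
  simp only [deg_eq_total, map_sub]

theorem deg_single {X : Type*} (x : X) (a : ℤ) : deg (Finsupp.single x a) = a := by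
  simp [deg_eq_total]

theorem deg_mapDomain {X Y : Type*} (f : X → Y) (D : X →₀ ℤ) :
    deg (D.mapDomain f) = deg D := by
  simp only [deg]
  exact Finsupp.sum_mapDomain_index (fun _ => rfl) fun _ _ _ => rfl

theorem Effective.deg_nonneg {X : Type*} {D : X →₀ ℤ} (hD : Effective D) : 0 ≤ deg D :=
  Finset.sum_nonneg fun x _ => hD x

theorem Effective.add {X : Type*} {D D' : X →₀ ℤ} (hD : Effective D) (hD' : Effective D') :
    Effective (D + D') := fun x => add_nonneg (hD x) (hD' x)

theorem effective_single {X : Type*} (x : X) {a : ℤ} (ha : 0 ≤ a) :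
    Effective (Finsupp.single x a) := fun y => by
  classical
  rw [Finsupp.single_apply]
  split_ifs <;> simp [ha]

/-- The sum of a tuple of points. -/
noncomputable def ofTuple {X : Type*} {N : ℕ} (x : Fin N → X) : X →₀ ℤ :=
  ∑ j, Finsupp.single (x j) 1

theorem deg_ofTuple {X : Type*} {N : ℕ} (x : Fin N → X) : deg (ofTuple x) = N := by
  simp [deg_eq_total, ofTuple, map_sum]

theorem effective_ofTuple {X : Type*} {N : ℕ} (x : Fin N → X) : Effective (ofTuple x) := by
  intro p
  rw [ofTuple, Finsupp.finsetSum_apply]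
  exact Finset.sum_nonneg fun j _ => effective_single (x j) zero_le_one p

theorem mapDomain_ofTuple {X Y : Type*} (f : X → Y) {N : ℕ} (x : Fin N → X) :
    (ofTuple x).mapDomain f = ofTuple fun j => f (x j) := by
  simp [ofTuple, Finsupp.mapDomain_finsetSum, Finsupp.mapDomain_single]

/-- Tuples of fixed length range over a compact space when the points do; this is how effective
divisors enter the limit arguments. -/
theorem Effective.exists_ofTuple {X : Type*} {N : ℕ} {D : X →₀ ℤ} (hD : Effective D)
    (hN : deg D = N) : ∃ x : Fin N → X, ofTuple x = D := by
  classical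
  induction N generalizing D with
  | zero =>
    refine ⟨Fin.elim0, ?_⟩
    have h0 : ∀ x ∈ D.support, D x = 0 :=
      (Finset.sum_eq_zero_iff_of_nonneg fun x _ => hD x).1 (by simpa [deg, Finsupp.sum] using hN)
    ext x
    by_cases hx : x ∈ D.support
    · simp [ofTuple, h0 x hx]
    · simp [ofTuple, Finsupp.notMem_support_iff.1 hx]
  | succ N ih =>
    obtain ⟨p, hp⟩ : ∃ p, D p ≠ 0 := by
      by_contra! h
      have : D = 0 := by ext x; simp [h x]
      rw [this] at hN
      simp [deg] at hN
      omega
    obtain ⟨x, hx⟩ := ih (D := D - Finsupp.single p 1) (fun q => by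
      rw [Finsupp.sub_apply, Finsupp.single_apply]
      have := hD q
      have := hD p
      split_ifs with h
      · subst h; omega
      · omega) (by rw [deg_sub, deg_single, hN]; push_cast; ring)
    refine ⟨Fin.cons p x, ?_⟩
    rw [ofTuple, Fin.sum_univ_succ]
    simp only [Fin.cons_zero, Fin.cons_succ]
    rw [ofTuple] at hx
    rw [hx]
    abel

/-- Boundedness and nonemptiness exclude the default value of `sSup`; downward closure turns
inequalities for ranks into domination statements. -/
theorem le_csSup_int_iff {S : Set ℤ} (hb : BddAbove S) (hne : S.Nonempty)
    (hdown : ∀ a ∈ S, ∀ b ≤ a, b ∈ S) (c : ℤ) : c ≤ sSup S ↔ c ∈ S :=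
  ⟨fun h => hdown _ (Int.csSup_mem hne hb) _ h, fun h => le_csSup hb h⟩

variable {X : Type*}

/-- The values `k` such that every effective divisor of degree `s + k` lies below an element of
`𝒟`. -/
def domination (𝒟 : Set (X →₀ ℤ)) (s : ℤ) : Set ℤ :=
  {k | ∀ E : X →₀ ℤ, Effective E → deg E = s + k → ∃ D ∈ 𝒟, Effective (D - E)}

theorem mem_domination_of_neg (𝒟 : Set (X →₀ ℤ)) {s k : ℤ} (h : s + k < 0) :
    k ∈ domination 𝒟 s := fun E hE hk => by
  have := hE.deg_nonneg
  omega

/-- Pad a divisor of smaller degree with a multiple of one point. -/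
theorem mem_domination_of_le [Nonempty X] {𝒟 : Set (X →₀ ℤ)} {s a b : ℤ}
    (ha : a ∈ domination 𝒟 s) (hb : b ≤ a) : b ∈ domination 𝒟 s := fun E hE hk => by
  obtain ⟨p⟩ := ‹Nonempty X›
  have h1 : Effective (Finsupp.single p (a - b)) := effective_single p (by omega)
  obtain ⟨D, hD, hDE⟩ := ha (E + Finsupp.single p (a - b)) (hE.add h1)
    (by rw [deg_add, deg_single, hk]; ring)
  refine ⟨D, hD, ?_⟩
  have := hDE.add h1
  rwa [show D - (E + Finsupp.single p (a - b)) + Finsupp.single p (a - b) = D - E by abel] at this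

theorem bddAbove_domination [Nonempty X] {𝒟 : Set (X →₀ ℤ)} {d : ℤ} (h𝒟 : ∀ D ∈ 𝒟, deg D = d)
    (s : ℤ) : BddAbove (domination 𝒟 s) := by
  obtain ⟨p⟩ := ‹Nonempty X›
  -- For negative `d` the values `k` with `s + k < 0` still qualify vacuously, whence the `-1`.
  refine ⟨max d (-1) - s, fun k hk => ?_⟩
  by_contra! h
  have h0 : 0 ≤ s + k := by have := le_max_right d (-1); omega
  obtain ⟨D, hD, hDE⟩ := hk (Finsupp.single p (s + k)) (effective_single p h0) (deg_single _ _)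
  have := hDE.deg_nonneg
  rw [deg_sub, deg_single, h𝒟 D hD] at this
  have := le_max_left d (-1)
  omega

theorem le_csSup_domination_iff [Nonempty X] {𝒟 : Set (X →₀ ℤ)} {d : ℤ}
    (h𝒟 : ∀ D ∈ 𝒟, deg D = d) (s c : ℤ) :
    c ≤ sSup (domination 𝒟 s) ↔ c ∈ domination 𝒟 s :=
  le_csSup_int_iff (bddAbove_domination h𝒟 s) ⟨-s - 1, mem_domination_of_neg _ (by omega)⟩
    (fun _ ha _ hb => mem_domination_of_le ha hb) c

variable [MetricSpace X] [Nonempty X]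

/-- Removes the supremum and the default `-1`: dominating in degree `r ≥ 0` already forces an
effective representative. -/
theorem le_rank_iff (hdeg : ∀ D : X →₀ ℤ, IsPrincipal D → deg D = 0) (D : X →₀ ℤ) (r : ℕ) :
    (r : ℤ) ≤ rank D ↔ (r : ℤ) ∈ domination {D' | LinEquiv D' D} 0 := by
  have hd : ∀ D' ∈ {D' | LinEquiv D' D}, deg D' = deg D := fun D' h => by
    have := hdeg _ h
    rw [deg_sub] at this
    omega
  have hS : {k : ℤ | ∀ E : X →₀ ℤ, Effective E → deg E = k →
      ∃ D', LinEquiv D' D ∧ Effective (D' - E)} = domination {D' | LinEquiv D' D} 0 := by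
    simp [domination]
  rw [rank, hS]
  split_ifs with h
  · exact le_csSup_domination_iff hd 0 r
  · refine ⟨fun h' => by omega, fun h' => (h ?_).elim⟩
    obtain ⟨D', h1, h2⟩ := mem_domination_of_le h' (Nat.cast_nonneg r) 0 (fun _ => le_rfl)
      (by simp [deg])
    exact ⟨D', h1, by simpa using h2⟩

theorem le_brillNoetherRank_iff (r d c : ℕ) : (c : ℤ) ≤ brillNoetherRank X r d ↔
      (c : ℤ) ∈ domination (brillNoetherLocus X r d) r := by
  rw [brillNoetherRank]
  split_ifs with h
  · exact le_csSup_domination_iff (fun D hD => hD.1) _ _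
  · refine ⟨fun h' => by omega, fun h' => (h ?_).elim⟩
    obtain ⟨p⟩ := ‹Nonempty X›
    obtain ⟨D, hD, -⟩ := h' (Finsupp.single p (r + c)) (effective_single p (by omega))
      (deg_single _ _)
    exact ⟨D, hD⟩

/-- If some `D` has rank at least `r`, every effective divisor of degree `r` lies below a divisor
equivalent to `D`, so `w^r_d ≥ 0`. The default `-1` is thus the minimum, as semicontinuity requires.
-/
theorem neg_one_le_brillNoetherRank (hdeg : ∀ D : X →₀ ℤ, IsPrincipal D → deg D = 0)
    (hadd : ∀ D D' : X →₀ ℤ, IsPrincipal D → IsPrincipal D' → IsPrincipal (D + D'))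
    (hneg : ∀ D : X →₀ ℤ, IsPrincipal D → IsPrincipal (-D)) (r d : ℕ) :
    -1 ≤ brillNoetherRank X r d := by
  rw [brillNoetherRank]
  split_ifs with h
  · refine le_trans (by norm_num)
      ((le_csSup_domination_iff (fun D hD => hD.1) _ 0).2 fun E hE hk => ?_)
    obtain ⟨D, hD, hr⟩ := h
    obtain ⟨D', h1, h2⟩ := (le_rank_iff hdeg D r).1 hr E hE (by omega)
    refine ⟨D', ⟨?_, (le_rank_iff hdeg D' r).2 fun E' hE' hk' => ?_⟩, h2⟩
    · have := hdeg _ h1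
      rw [deg_sub] at this
      omega
    · obtain ⟨D'', h3, h4⟩ := (le_rank_iff hdeg D r).1 hr E' hE' hk'
      refine ⟨D'', ?_, h4⟩
      have := hadd _ _ h3 (hneg _ h1)
      rwa [show D'' - D + -(D' - D) = D'' - D' by abel] at this
  · exact le_rfl

end Rank

/-! ### From labels to points of the realization -/

namespace Graph

variable {G : Graph}

/-- The point of the disjoint union of the edges and the vertices with a given label. -/
def toPre (l : G.Cone) : Model G → Pre G l
  | .inl v => .vert v
  | .inr (e, s) => .edge e s

/-- The point of the realization with a given label. -/
noncomputable def pt (l : G.Cone) (x : Model G) : Realization l := SeparationQuotient.mk (toPre l x)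

theorem pt_surjective (l : G.Cone) : Function.Surjective (pt l) := by
  intro p
  obtain ⟨x, rfl⟩ := SeparationQuotient.surjective_mk p
  cases x with
  | vert v => exact ⟨.inl v, rfl⟩
  | edge e s => exact ⟨.inr (e, s), rfl⟩

end Graph

/-! ### Stars -/

section Star

variable {X ι κ : Type*} [MetricSpace X]

/-- A star chart whose branches are indexed by an arbitrary type. -/
structure IsStar (p : X) (ε : ℝ) (ψ : ι → ℝ → X) : Prop where
  pos : 0 < ε
  center : ∀ i, ψ i 0 = p
  dist_same : ∀ i, ∀ s ∈ Set.Icc 0 ε, ∀ t ∈ Set.Icc 0 ε, dist (ψ i s) (ψ i t) = |s - t|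
  dist_ne : ∀ i j, i ≠ j → ∀ s ∈ Set.Icc 0 ε, ∀ t ∈ Set.Icc 0 ε, dist (ψ i s) (ψ j t) = s + t
  covers : ∀ x, dist x p < ε → x = p ∨ ∃ i, ∃ t ∈ Set.Icc 0 ε, ψ i t = x

theorem IsStarChart.isStar {p : X} {ε : ℝ} {n : ℕ} {φ : Fin n → ℝ → X} (h : IsStarChart p ε φ) :
    IsStar p ε φ where
  pos := h.pos
  center := h.center
  dist_same i s hs t ht := by rw [h.dist_eq i i s hs t ht, if_pos rfl]
  dist_ne i j hij s hs t ht := by rw [h.dist_eq i j s hs t ht, if_neg hij]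
  covers := h.covers

theorem IsStar.isStarChart {p : X} {ε : ℝ} {n : ℕ} {φ : Fin n → ℝ → X} (h : IsStar p ε φ) :
    IsStarChart p ε φ where
  pos := h.pos
  center := h.center
  dist_eq i j s hs t ht := by
    split_ifs with hij
    · subst hij; exact h.dist_same i s hs t ht
    · exact h.dist_ne i j hij s hs t ht
  covers := h.covers

theorem IsStar.dist_center {p : X} {ε : ℝ} {ψ : ι → ℝ → X} (h : IsStar p ε ψ) (i : ι) {t : ℝ}
    (ht : t ∈ Set.Icc 0 ε) : dist (ψ i t) p = t := by
  rw [← h.center i, h.dist_same i t ht 0 ⟨le_rfl, h.pos.le⟩, sub_zero, abs_of_nonneg ht.1]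

theorem IsStar.mono {p : X} {ε δ : ℝ} {ψ : ι → ℝ → X} (h : IsStar p ε ψ) (hδ : 0 < δ)
    (hle : δ ≤ ε) : IsStar p δ ψ where
  pos := hδ
  center := h.center
  dist_same i s hs t ht := h.dist_same i s ⟨hs.1, hs.2.trans hle⟩ t ⟨ht.1, ht.2.trans hle⟩
  dist_ne i j hij s hs t ht :=
    h.dist_ne i j hij s ⟨hs.1, hs.2.trans hle⟩ t ⟨ht.1, ht.2.trans hle⟩
  covers x hx := (h.covers x (hx.trans_le hle)).imp_right fun ⟨i, t, ht, hti⟩ => by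
    subst hti
    rw [h.dist_center i ht] at hx
    exact ⟨i, t, ⟨ht.1, hx.le⟩, rfl⟩

theorem IsStar.comp_equiv {p : X} {ε : ℝ} {ψ : ι → ℝ → X} (h : IsStar p ε ψ) (σ : κ ≃ ι) :
    IsStar p ε fun k => ψ (σ k) where
  pos := h.pos
  center k := h.center _
  dist_same k := h.dist_same _
  dist_ne k k' hk := h.dist_ne _ _ (σ.injective.ne hk)
  covers x hx := (h.covers x hx).imp_right fun ⟨i, t, ht, hti⟩ => ⟨σ.symm i, t, ht, by simpa⟩

/-- A geodesic from the centre cannot change branches: points at times `t < η` on different branches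
have distance `t + η`, not `η - t`. -/
theorem IsStar.exists_eq_branch {p : X} {ε δ : ℝ} {ψ : ι → ℝ → X} (h : IsStar p ε ψ) (hδ : 0 < δ)
    {γ : ℝ → X} (h0 : γ 0 = p)
    (hγ : ∀ s ∈ Set.Icc 0 δ, ∀ t ∈ Set.Icc 0 δ, dist (γ s) (γ t) = |s - t|) :
    ∃ i, ∀ᶠ t in 𝓝[>] 0, γ t = ψ i t := by
  set η := min δ (ε / 2) with hη
  have hη0 : 0 < η := lt_min hδ (half_pos h.pos)
  have hηδ : η ≤ δ := min_le_left _ _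
  have hηε : η < ε := (min_le_right _ _).trans_lt (half_lt_self h.pos)
  have key : ∀ t ∈ Set.Ioc 0 η, ∃ i, γ t = ψ i t := by
    intro t ht
    have hd : dist (γ t) p = t := by
      rw [← h0, hγ t ⟨ht.1.le, ht.2.trans hηδ⟩ 0 ⟨le_rfl, hδ.le⟩, sub_zero, abs_of_pos ht.1]
    rcases h.covers (γ t) (by rw [hd]; exact ht.2.trans_lt hηε) with h1 | ⟨i, s, hs, h1⟩
    · rw [h1, dist_self] at hd
      exact absurd hd.symm ht.1.ne'
    · rw [← h1, h.dist_center i hs] at hd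
      subst hd
      exact ⟨i, h1.symm⟩
  obtain ⟨i, hi⟩ := key η ⟨hη0, le_rfl⟩
  refine ⟨i, ?_⟩
  filter_upwards [Ioc_mem_nhdsGT hη0] with t ht
  obtain ⟨j, hj⟩ := key t ht
  rcases eq_or_ne j i with rfl | hne
  · exact hj
  · have h1 := hγ t ⟨ht.1.le, ht.2.trans hηδ⟩ η ⟨hη0.le, hηδ⟩
    rw [hj, hi, h.dist_ne j i hne t ⟨ht.1.le, ht.2.trans hηε.le⟩ η ⟨hη0.le, hηε.le⟩] at h1
    rw [abs_of_nonpos (by linarith [ht.2])] at h1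
    linarith [ht.1]

theorem IsStar.branch_injective {p : X} {ε : ℝ} {ψ : ι → ℝ → X} (h : IsStar p ε ψ) {i j : ι}
    (hij : ∀ᶠ t in 𝓝[>] 0, ψ i t = ψ j t) : i = j := by
  by_contra hne
  obtain ⟨t, ht, ht'⟩ := (hij.and (Ioc_mem_nhdsGT h.pos)).exists
  have h1 := h.dist_ne i j hne t ⟨ht'.1.le, ht'.2⟩ t ⟨ht'.1.le, ht'.2⟩
  rw [ht, dist_self] at h1
  linarith [ht'.1]

/-- Tangent directions are intrinsic: each branch of one star is a geodesic, so its germ is a branch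
of the other. -/
theorem IsStar.exists_equiv {p : X} {ε δ : ℝ} {ψ : ι → ℝ → X} {φ : κ → ℝ → X}
    (h : IsStar p ε ψ) (h' : IsStar p δ φ) :
    ∃ σ : ι ≃ κ, ∀ i, ∀ᶠ t in 𝓝[>] 0, ψ i t = φ (σ i) t := by
  choose σ hσ using fun i => h'.exists_eq_branch h.pos (h.center i) (h.dist_same i)
  choose τ hτ using fun k => h.exists_eq_branch h'.pos (h'.center k) (h'.dist_same k)
  refine ⟨⟨σ, τ, fun i => h.branch_injective ?_, fun k => h'.branch_injective ?_⟩, hσ⟩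
  · filter_upwards [hσ i, hτ (σ i)] with t h1 h2
    rw [h1, h2]
  · filter_upwards [hτ k, hσ (τ k)] with t h1 h2
    rw [h1, h2]

/-- Orders depend only on germs of branches, so any convenient star may be used to compute them. -/
theorem IsStar.hasOrderAt_iff [Fintype ι] {p : X} {ε : ℝ} {ψ : ι → ℝ → X} (h : IsStar p ε ψ)
    {f : X → ℝ} {k : ℤ} : HasOrderAt f p k ↔
      ∃ m : ι → ℤ, (∀ i, ∀ᶠ t in 𝓝[>] 0, f (ψ i t) = f p + m i * t) ∧ k = -∑ i, m i := by
  constructor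
  · rintro ⟨n, δ, φ, m, hφ, hm, hk⟩
    obtain ⟨σ, hσ⟩ := h.exists_equiv hφ.isStar
    refine ⟨fun i => m (σ i), fun i => ?_, by rw [hk, σ.sum_comp m]⟩
    filter_upwards [hσ i, Ioc_mem_nhdsGT hφ.pos] with t h1 h2
    rw [h1, hm _ t ⟨h2.1.le, h2.2⟩]
  · rintro ⟨m, hm, hk⟩
    obtain ⟨δ, hδ, hδm⟩ := mem_nhdsGT_iff_exists_Ioc_subset.1 (eventually_all.2 hm)
    have hpos : 0 < min δ ε := lt_min hδ h.pos
    let σ := (Fintype.equivFin ι).symm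
    refine ⟨_, min δ ε, fun j => ψ (σ j), fun j => m (σ j),
      ((h.mono hpos (min_le_right _ _)).comp_equiv σ).isStarChart, fun j t ht => ?_, ?_⟩
    · rcases ht.1.eq_or_lt with rfl | h0
      · simp [h.center]
      · exact hδm ⟨h0, ht.2.trans (min_le_left _ _)⟩ (σ j)
    · rw [hk, σ.sum_comp m]

/-- Upper bounds for distances come from the branches; the matching lower bounds come from
1-Lipschitz functions growing along one branch and decreasing along all others. -/
theorem IsStar.of_functions {p : X} {ε : ℝ} {ψ : ι → ℝ → X} (hε : 0 < ε)
    (hcenter : ∀ i, ψ i 0 = p)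
    (hle : ∀ i, ∀ s ∈ Set.Icc 0 ε, ∀ t ∈ Set.Icc 0 ε, dist (ψ i s) (ψ i t) ≤ |s - t|)
    (hF : ∀ i, ∃ F : X → ℝ, (∀ x y, |F x - F y| ≤ dist x y) ∧
      (∀ s ∈ Set.Icc 0 ε, F (ψ i s) = s) ∧ ∀ j ≠ i, ∀ s ∈ Set.Icc 0 ε, F (ψ j s) = -s)
    (hcovers : ∀ x, dist x p < ε → x = p ∨ ∃ i, ∃ t ∈ Set.Icc 0 ε, ψ i t = x) :
    IsStar p ε ψ where
  pos := hε
  center := hcenter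
  dist_same i s hs t ht := by
    obtain ⟨F, hF1, hF2, -⟩ := hF i
    refine le_antisymm (hle i s hs t ht) ?_
    have := hF1 (ψ i s) (ψ i t)
    rwa [hF2 s hs, hF2 t ht] at this
  dist_ne i j hij s hs t ht := by
    obtain ⟨F, hF1, hF2, hF3⟩ := hF i
    refine le_antisymm ?_ ?_
    · have h0 : (0 : ℝ) ∈ Set.Icc 0 ε := ⟨le_rfl, hε.le⟩
      have h1 := hle i s hs 0 h0
      have h2 := hle j 0 h0 t ht
      rw [hcenter, sub_zero, abs_of_nonneg hs.1] at h1
      rw [hcenter, zero_sub, abs_neg, abs_of_nonneg ht.1] at h2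
      exact (dist_triangle _ p _).trans (add_le_add h1 h2)
    · have := hF1 (ψ i s) (ψ j t)
      rw [hF2 s hs, hF3 j hij.symm t ht, sub_neg_eq_add] at this
      exact (le_abs_self _).trans this
  covers := hcovers

end Star

namespace Graph

variable {G : Graph}

/-! ### Lipschitz functions on realizations -/

/-- `F` is the pullback of a `C`-Lipschitz function on the realization. -/
structure IsLipschitz (l : G.Cone) (C : ℝ) (F : Model G → ℝ) : Prop where
  src : ∀ e, F (.inr (e, 0)) = F (.inl (G.src e))
  tgt : ∀ e, F (.inr (e, 1)) = F (.inl (G.tgt e))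
  seg : ∀ e s t, |F (.inr (e, s)) - F (.inr (e, t))| ≤ C * (l.1 e * |(s : ℝ) - t|)

/-- The label of a point of the disjoint union of the edges and the vertices. -/
def ofPre {l : G.Cone} : Pre G l → Model G
  | .vert v => .inl v
  | .edge e s => .inr (e, s)

theorem ofPre_toPre (l : G.Cone) (x : Model G) : ofPre (toPre l x) = x := by
  rcases x with v | ⟨e, s⟩ <;> rfl

theorem Path.abs_sub_le {l : G.Cone} {C : ℝ} {F : Model G → ℝ} (hF : IsLipschitz l C F)
    {x y : Pre G l} {L : ℝ} (h : Path l x y L) : |F (ofPre x) - F (ofPre y)| ≤ C * L := by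
  induction h with
  | refl x => simp
  | src e => simp [ofPre, hF.src]
  | tgt e => simp [ofPre, hF.tgt]
  | seg e s t => exact hF.seg e s t
  | symm _ ih => rwa [abs_sub_comm]
  | trans _ _ ih ih' =>
    rw [mul_add]
    exact (_root_.abs_sub_le _ _ _).trans (add_le_add ih ih')

theorem dist_pt (l : G.Cone) (x y : Model G) :
    dist (pt l x) (pt l y) = sInf {L | Path l (toPre l x) (toPre l y) L} := rfl

theorem dist_pt_le_of_path {l : G.Cone} {x y : Model G} {L : ℝ}
    (h : Path l (toPre l x) (toPre l y) L) : dist (pt l x) (pt l y) ≤ L := by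
  rw [dist_pt]
  exact csInf_le ⟨0, fun _ h => h.nonneg⟩ h

/-- The source of all lower bounds for the path metric, which is an infimum over paths. -/
theorem IsLipschitz.abs_sub_le {l : G.Cone} {C : ℝ} {F : Model G → ℝ} (hF : IsLipschitz l C F)
    (hC : 0 ≤ C) (x y : Model G) : |F x - F y| ≤ C * dist (pt l x) (pt l y) := by
  rw [dist_pt]
  refine le_of_forall_pos_le_add fun δ hδ => ?_
  -- The slack is `δ / (C + 1)` since `C` may be zero.
  obtain ⟨L, h, hL⟩ := exists_lt_of_csInf_lt (s := {L | Path l (toPre l x) (toPre l y) L})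
    (Path.exists l _ _) (lt_add_of_pos_right _ (div_pos hδ (by linarith : 0 < C + 1)))
  have h1 := Path.abs_sub_le hF h
  rw [ofPre_toPre, ofPre_toPre] at h1
  have h2 := mul_le_mul_of_nonneg_left hL.le hC
  have h3 : C * (δ / (C + 1)) ≤ δ := by
    rw [mul_div_assoc', div_le_iff₀ (by linarith)]
    nlinarith
  linarith

theorem IsLipschitz.exists_lift {l : G.Cone} {C : ℝ} {F : Model G → ℝ} (hF : IsLipschitz l C F)
    (hC : 0 ≤ C) : ∃ f : Realization l → ℝ, (∀ x, f (pt l x) = F x) ∧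
      ∀ p q, |f p - f q| ≤ C * dist p q := by
  have hinv := Function.surjInv_eq (pt_surjective l)
  refine ⟨fun p => F (Function.surjInv (pt_surjective l) p), fun x => ?_, fun p q => ?_⟩
  · have := hF.abs_sub_le hC (Function.surjInv (pt_surjective l) (pt l x)) x
    rw [hinv, dist_self, mul_zero] at this
    exact sub_eq_zero.1 (abs_nonpos_iff.1 this)
  · have := hF.abs_sub_le hC (Function.surjInv (pt_surjective l) p)
      (Function.surjInv (pt_surjective l) q)
    rwa [hinv, hinv] at this

theorem pt_src (l : G.Cone) (e : Fin G.n) : pt l (.inr (e, 0)) = pt l (.inl (G.src e)) :=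
  dist_le_zero.1 (dist_pt_le_of_path (Path.src e))

theorem pt_tgt (l : G.Cone) (e : Fin G.n) : pt l (.inr (e, 1)) = pt l (.inl (G.tgt e)) :=
  dist_le_zero.1 (dist_pt_le_of_path (Path.tgt e))

theorem dist_pt_edge_le (l : G.Cone) (e : Fin G.n) (s t : unitInterval) :
    dist (pt l (.inr (e, s))) (pt l (.inr (e, t))) ≤ l.1 e * |(s : ℝ) - t| :=
  dist_pt_le_of_path (Path.seg e s t)

theorem pt_edge_of_eq_zero {l : G.Cone} {e : Fin G.n} (h : l.1 e = 0) (s : unitInterval) :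
    pt l (.inr (e, s)) = pt l (.inl (G.src e)) := by
  rw [← pt_src]
  refine dist_le_zero.1 ((dist_pt_edge_le l e s 0).trans ?_)
  rw [h, zero_mul]

theorem pt_src_eq_pt_tgt {l : G.Cone} {e : Fin G.n} (h : l.1 e = 0) :
    pt l (.inl (G.src e)) = pt l (.inl (G.tgt e)) := by
  rw [← pt_tgt, pt_edge_of_eq_zero h]

/-! ### Tents -/

/-- The function with a tent of height `ε` on the interval `[0, 2 * ε]`. -/
noncomputable def tent (ε y : ℝ) : ℝ := max 0 (min y (2 * ε - y))

theorem tent_of_mem {ε y : ℝ} (h : y ∈ Set.Icc 0 ε) : tent ε y = y := by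
  rw [tent, min_eq_left (by linarith [h.2]), max_eq_right h.1]

theorem tent_of_nonpos {ε y : ℝ} (h : y ≤ 0) : tent ε y = 0 :=
  max_eq_left ((min_le_left _ _).trans h)

theorem tent_of_ge {ε y : ℝ} (h : 2 * ε ≤ y) : tent ε y = 0 :=
  max_eq_left ((min_le_right _ _).trans (by linarith))

theorem abs_tent_sub_tent_le (ε x y : ℝ) : |tent ε x - tent ε y| ≤ |x - y| := by
  refine (abs_max_sub_max_le_max _ _ _ _).trans (max_le (by simp) ?_)
  refine (abs_min_sub_min_le_max _ _ _ _).trans (max_le le_rfl ?_)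
  rw [show 2 * ε - x - (2 * ε - y) = -(x - y) by ring, abs_neg]

/-- The two functions vary on opposite sides of `z`, so their variations are paid for by disjoint
parts of the interval. -/
theorem abs_sub_add_abs_sub_le_of_separated {f g : ℝ → ℝ} {z : ℝ}
    (hf : ∀ x y, |f x - f y| ≤ |x - y|) (hg : ∀ x y, |g x - g y| ≤ |x - y|)
    (hfz : ∀ x ≤ z, f x = 0) (hgz : ∀ x, z ≤ x → g x = 0) (x y : ℝ) :
    |f x - f y| + |g x - g y| ≤ |x - y| := by
  wlog hxy : x ≤ y generalizing x y
  · rw [abs_sub_comm, abs_sub_comm (g x), abs_sub_comm x]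
    exact this y x (le_of_not_ge hxy)
  rcases le_total y z with hy | hy
  · rw [hfz y hy, hfz x (hxy.trans hy)]
    simpa using hg x y
  rcases le_total z x with hx | hx
  · rw [hgz y hy, hgz x hx]
    simpa using hf x y
  have h1 := hf z y
  have h2 := hg x z
  rw [hfz z le_rfl] at h1
  rw [hgz z le_rfl] at h2
  rw [hfz x hx, hgz y hy]
  rw [abs_of_nonpos (sub_nonpos.2 hy)] at h1
  rw [abs_of_nonpos (sub_nonpos.2 hx)] at h2
  rw [abs_of_nonpos (sub_nonpos.2 hxy)]
  linarith

/-- The supports `[a, a + 2ε]` and `[b - 2ε, b]` do not overlap: either they point away from each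
other, or they face each other with enough space between. -/
theorem abs_tent_sub_add_abs_tent_sub_le {ε a b : ℝ} (h : b ≤ a ∨ a + 4 * ε ≤ b) (x y : ℝ) :
    |tent ε (x - a) - tent ε (y - a)| + |tent ε (b - x) - tent ε (b - y)| ≤ |x - y| := by
  have h1 : ∀ x y, |tent ε (x - a) - tent ε (y - a)| ≤ |x - y| := fun x y => by
    simpa using abs_tent_sub_tent_le ε (x - a) (y - a)
  have h2 : ∀ x y, |tent ε (b - x) - tent ε (b - y)| ≤ |x - y| := fun x y => by
    simpa [abs_sub_comm] using abs_tent_sub_tent_le ε (b - x) (b - y)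
  rcases h with h | h
  · exact abs_sub_add_abs_sub_le_of_separated (z := a) h1 h2
      (fun x hx => tent_of_nonpos (by linarith)) (fun x hx => tent_of_nonpos (by linarith)) x y
  · rw [add_comm]
    exact abs_sub_add_abs_sub_le_of_separated (z := a + 2 * ε) h2 h1
      (fun x hx => tent_of_ge (by linarith)) (fun x hx => tent_of_ge (by linarith)) x y

/-- The sign of a direction along an edge: `false` is the positive and `true` the negative
direction. -/
def sgn (b : Bool) : ℤ := if b then -1 else 1

@[simp] theorem sgn_false : sgn false = 1 := rfl

@[simp] theorem sgn_true : sgn true = -1 := rfl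

/-- The point at distance `y`, in direction `b`, from the point of the edge `e` with coordinate
`u`. -/
noncomputable def ray (l : G.Cone) (e : Fin G.n) (b : Bool) (u y : ℝ) : Realization l :=
  pt l (.inr (e, Set.projIcc 0 1 zero_le_one (u + sgn b * (y / l.1 e))))

theorem dist_ray_le {l : G.Cone} {e : Fin G.n} (he : 0 < l.1 e) (b : Bool) (u y y' : ℝ) :
    dist (ray l e b u y) (ray l e b u y') ≤ |y - y'| := by
  refine (dist_pt_edge_le _ _ _ _).trans ?_
  have h1 := Set.abs_projIcc_sub_projIcc (zero_le_one (α := ℝ)) (c := u + sgn b * (y / l.1 e))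
    (d := u + sgn b * (y' / l.1 e))
  have h2 : |u + sgn b * (y / l.1 e) - (u + sgn b * (y' / l.1 e))| = |y - y'| / l.1 e := by
    rw [show u + sgn b * (y / l.1 e) - (u + sgn b * (y' / l.1 e)) =
      sgn b * ((y - y') / l.1 e) by ring, abs_mul, abs_div, abs_of_pos he]
    cases b <;> simp
  rw [h2] at h1
  calc _ ≤ l.1 e * (|y - y'| / l.1 e) := mul_le_mul_of_nonneg_left h1 he.le
    _ = _ := mul_div_cancel₀ _ he.ne'

/-- From the points with coordinates `U e b` on the edges `e`, in the directions `b`, there start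
disjoint segments of length `2 * ε`, where an edge of length zero and a direction at an end of an
edge that leads out of it are disregarded. -/
structure Admissible (l : G.Cone) (ε : ℝ) (U : Fin G.n → Bool → ℝ) : Prop where
  pos : 0 < ε
  nonneg : ∀ e b, 0 ≤ U e b
  le_one : ∀ e b, U e b ≤ 1
  left : ∀ e, l.1 e = 0 ∨ U e false = 1 ∨ 2 * ε ≤ l.1 e * (1 - U e false)
  right : ∀ e, l.1 e = 0 ∨ U e true = 0 ∨ 2 * ε ≤ l.1 e * U e true
  sep : ∀ e, l.1 e = 0 ∨ U e true ≤ U e false ∨ l.1 e * U e false + 4 * ε ≤ l.1 e * U e true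

/-- A function with tents with signs `c e b` over the segments starting from `U e b`. -/
noncomputable def tents (l : G.Cone) (ε : ℝ) (U : Fin G.n → Bool → ℝ) (c : Fin G.n → Bool → ℝ) :
    Model G → ℝ
  | .inl _ => 0
  | .inr (e, s) => c e false * tent ε (l.1 e * s - l.1 e * U e false) +
      c e true * tent ε (l.1 e * U e true - l.1 e * s)

theorem Admissible.isLipschitz_tents {l : G.Cone} {ε : ℝ} {U : Fin G.n → Bool → ℝ}
    (hU : Admissible l ε U) {c : Fin G.n → Bool → ℝ} (hc : ∀ e b, |c e b| ≤ 1) :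
    IsLipschitz l 1 (tents l ε U c) := by
  have t0 : tent ε 0 = 0 := tent_of_nonpos le_rfl
  refine ⟨fun e => ?_, fun e => ?_, fun e s t => ?_⟩
  · have h1 : tent ε (0 - l.1 e * U e false) = 0 :=
      tent_of_nonpos (by have := mul_nonneg (l.2.1 e) (hU.nonneg e false); linarith)
    have h2 : tent ε (l.1 e * U e true - 0) = 0 := by
      rcases hU.right e with h | h | h
      · simp [h, t0]
      · simp [h, t0]
      · exact tent_of_ge (by linarith)
    simp only [tents, Set.Icc.coe_zero, mul_zero, h1, h2, add_zero]
  · have h1 : tent ε (l.1 e * U e true - l.1 e * 1) = 0 :=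
      tent_of_nonpos (by
        have := mul_nonneg (l.2.1 e) (sub_nonneg.2 (hU.le_one e true)); linarith)
    have h2 : tent ε (l.1 e * 1 - l.1 e * U e false) = 0 := by
      rcases hU.left e with h | h | h
      · simp [h, t0]
      · simp [h, t0]
      · exact tent_of_ge (by linarith)
    simp only [tents, Set.Icc.coe_one, h1, h2, mul_zero, add_zero]
  · rcases hU.sep e with h | h | h
    · simp [tents, h]
    all_goals
      have h' : l.1 e * U e true ≤ l.1 e * U e false ∨
          l.1 e * U e false + 4 * ε ≤ l.1 e * U e true := by
        first
          | exact Or.inr h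
          | exact Or.inl (mul_le_mul_of_nonneg_left h (l.2.1 e))
      have h3 := abs_tent_sub_add_abs_tent_sub_le h' (l.1 e * s) (l.1 e * t)
      rw [← mul_sub (l.1 e) (s : ℝ) t, abs_mul, abs_of_nonneg (l.2.1 e)] at h3
      rw [one_mul]
      refine le_trans ?_ h3
      simp only [tents]
      rw [show ∀ a b x y z w : ℝ, a * x + b * y - (a * z + b * w) = a * (x - z) + b * (y - w) by
        intros; ring]
      refine (abs_add_le _ _).trans (add_le_add ?_ ?_) <;>
      · rw [abs_mul]
        exact mul_le_of_le_one_left (abs_nonneg _) (hc e _)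

/-- The segment of length `2 * ε` in direction `b` from the point with coordinate `u` of the edge `e`
lies within this edge. -/
def HasRoom (l : G.Cone) (ε : ℝ) (e : Fin G.n) (b : Bool) (u : ℝ) : Prop :=
  0 < l.1 e ∧ 0 ≤ u + sgn b * (2 * ε / l.1 e) ∧ u + sgn b * (2 * ε / l.1 e) ≤ 1

theorem Admissible.tents_ray {l : G.Cone} {ε : ℝ} {U : Fin G.n → Bool → ℝ}
    (hU : Admissible l ε U) {c : Fin G.n → Bool → ℝ} {f : Realization l → ℝ}
    (hf : ∀ x, f (pt l x) = tents l ε U c x) {e : Fin G.n} {b : Bool}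
    (h : HasRoom l ε e b (U e b)) {y : ℝ} (hy : y ∈ Set.Icc 0 ε) :
    f (ray l e b (U e b) y) = c e b * y := by
  obtain ⟨hl, h0, h1⟩ := h
  have hyl : y / l.1 e ≤ 2 * ε / l.1 e :=
    div_le_div_of_nonneg_right (by linarith [hy.2, hU.pos]) hl.le
  have hyl0 : 0 ≤ y / l.1 e := div_nonneg hy.1 hl.le
  have hmem : U e b + sgn b * (y / l.1 e) ∈ Set.Icc (0 : ℝ) 1 := by
    have := hU.nonneg e b
    have := hU.le_one e b
    cases b <;> simp only [sgn_false, sgn_true, Int.cast_one, Int.cast_neg] at * <;>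
      constructor <;> linarith
  rw [ray, hf, Set.projIcc_of_mem _ hmem]
  simp only [tents]
  have hcancel : l.1 e * (y / l.1 e) = y := mul_div_cancel₀ _ hl.ne'
  have hcancel' : l.1 e * (2 * ε / l.1 e) = 2 * ε := mul_div_cancel₀ _ hl.ne'
  have hp := hU.pos
  have hsep := (hU.sep e).resolve_left hl.ne'
  cases b
  · simp only [sgn_false, Int.cast_one, one_mul, mul_add, hcancel]
    rw [add_sub_cancel_left, tent_of_mem hy]
    have : tent ε (l.1 e * U e true - (l.1 e * U e false + y)) = 0 := by
      rcases hsep with h | h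
      · exact tent_of_nonpos (by
          have := mul_le_mul_of_nonneg_left h hl.le; linarith [hy.1])
      · exact tent_of_ge (by linarith [hy.2])
    rw [this]; ring
  · simp only [sgn_true, Int.cast_neg, Int.cast_one, neg_mul, one_mul, mul_add, mul_neg, hcancel]
    rw [show l.1 e * U e true - (l.1 e * U e true + -y) = y by ring, tent_of_mem hy]
    have : tent ε (l.1 e * U e true + -y - l.1 e * U e false) = 0 := by
      rcases hsep with h | h
      · exact tent_of_nonpos (by
          have := mul_le_mul_of_nonneg_left h hl.le; linarith [hy.1])
      · exact tent_of_ge (by linarith [hy.2])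
    rw [this]; ring

theorem Admissible.isStar {l : G.Cone} {ε : ℝ} {U : Fin G.n → Bool → ℝ} (hU : Admissible l ε U)
    {p : Realization l} {ι : Type*} {d : ι → Fin G.n × Bool} (hd : Function.Injective d)
    (hroom : ∀ i, HasRoom l ε (d i).1 (d i).2 (U (d i).1 (d i).2))
    (hp : ∀ i, ray l (d i).1 (d i).2 (U (d i).1 (d i).2) 0 = p)
    (hcovers : ∀ x, dist x p < ε → x = p ∨ ∃ i, ∃ t ∈ Set.Icc 0 ε,
      ray l (d i).1 (d i).2 (U (d i).1 (d i).2) t = x) :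
    IsStar p ε fun i => ray l (d i).1 (d i).2 (U (d i).1 (d i).2) := by
  refine IsStar.of_functions hU.pos hp (fun i s _ t _ => dist_ray_le (hroom i).1 _ _ _ _)
    (fun i => ?_) hcovers
  -- Sign `1` on the chosen branch and `-1` elsewhere gives the values `s` and `-t`, whose
  -- difference is the distance `s + t` through the centre.
  obtain ⟨f, hf, hf'⟩ := (hU.isLipschitz_tents
    (c := fun e b => if (e, b) = d i then 1 else -1)
    (fun e b => by split_ifs <;> simp)).exists_lift zero_le_one
  refine ⟨f, fun x y => by simpa using hf' x y, fun s hs => ?_, fun j hj s hs => ?_⟩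
  · rw [hU.tents_ray hf (hroom i) hs, if_pos rfl, one_mul]
  · rw [hU.tents_ray hf (hroom j) hs, if_neg (hd.ne hj), neg_one_mul]

/-! ### Star charts of realizations -/

/-- The end vertex of the edge `e` at which the direction `b` starts. -/
def endpt (e : Fin G.n) (b : Bool) : Fin G.m := if b then G.tgt e else G.src e

/-- The coordinate of the end of an edge at which the direction `b` starts. -/
def endCoord (b : Bool) : ℝ := if b then 1 else 0

theorem exists_pos_four_mul_le (l : G.Cone) :
    ∃ ε > 0, ∀ e, l.1 e ≠ 0 → 4 * ε ≤ l.1 e := by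
  have h : ∀ᶠ ε in 𝓝[>] (0 : ℝ), ∀ e, l.1 e ≠ 0 → 4 * ε ≤ l.1 e := by
    refine eventually_all.2 fun e => ?_
    by_cases he : l.1 e = 0
    · exact Eventually.of_forall fun _ h => (h he).elim
    · have hpos : 0 < l.1 e / 4 := div_pos ((l.2.1 e).lt_of_ne' he) (by norm_num)
      filter_upwards [Ioc_mem_nhdsGT hpos] with ε hε _
      linarith [hε.2]
  obtain ⟨ε, h1, h2⟩ := (h.and self_mem_nhdsWithin).exists
  exact ⟨ε, h2, h1⟩

theorem abs_min_sub_min_right_le (a b c : ℝ) : |min a c - min b c| ≤ |a - b| := by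
  refine (abs_min_sub_min_le_max _ _ _ _).trans (by simp)

open Classical in
/-- The distance from a point `p` in the image of the vertices, cut off at a small `ε`. -/
noncomputable def vertexDist (l : G.Cone) (p : Realization l) (ε : ℝ) : Model G → ℝ
  | .inl v => if pt l (.inl v) = p then 0 else ε
  | .inr (e, s) => min (min ((if pt l (.inl (G.src e)) = p then 0 else ε) + l.1 e * s)
      ((if pt l (.inl (G.tgt e)) = p then 0 else ε) + l.1 e * (1 - s))) ε

-- Serves to show that a point close to a vertex lies on an edge issuing from its image. At the ends
-- of a contracted edge the two vertex terms agree because both ends give the same point.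
open Classical in
theorem isLipschitz_vertexDist {l : G.Cone} (p : Realization l) {ε : ℝ} (hε : 0 < ε)
    (hl : ∀ e, l.1 e ≠ 0 → 4 * ε ≤ l.1 e) : IsLipschitz l 1 (vertexDist l p ε) := by
  have h01 : ∀ v : Fin G.m, 0 ≤ (if pt l (.inl v) = p then 0 else ε) ∧
      (if pt l (.inl v) = p then 0 else ε) ≤ ε := fun v => by
    split_ifs <;> constructor <;> linarith
  refine ⟨fun e => ?_, fun e => ?_, fun e s t => ?_⟩
  · simp only [vertexDist, Set.Icc.coe_zero, mul_zero, add_zero, sub_zero, mul_one]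
    obtain ⟨h1, h2⟩ := h01 (G.src e)
    obtain ⟨h3, h4⟩ := h01 (G.tgt e)
    by_cases he : l.1 e = 0
    · rw [he, pt_src_eq_pt_tgt he]
      simp only [add_zero, min_self]
      exact min_eq_left h4
    · have := hl e he
      rw [min_eq_left ((min_le_left _ _).trans h2)]
      exact min_eq_left (by linarith)
  · simp only [vertexDist, Set.Icc.coe_one, mul_zero, add_zero, sub_self, mul_one]
    obtain ⟨h1, h2⟩ := h01 (G.src e)
    obtain ⟨h3, h4⟩ := h01 (G.tgt e)
    by_cases he : l.1 e = 0
    · rw [he, pt_src_eq_pt_tgt he]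
      simp only [add_zero, min_self]
      exact min_eq_left h4
    · have := hl e he
      rw [min_eq_left ((min_le_right _ _).trans h4)]
      exact min_eq_right (by linarith)
  · simp only [vertexDist, one_mul]
    refine (abs_min_sub_min_right_le _ _ _).trans
      ((abs_min_sub_min_le_max _ _ _ _).trans (max_le (le_of_eq ?_) (le_of_eq ?_)))
    · rw [add_sub_add_left_eq_sub, ← mul_sub (l.1 e) (s : ℝ) t, abs_mul, abs_of_nonneg (l.2.1 e)]
    · rw [add_sub_add_left_eq_sub, ← mul_sub (l.1 e) (1 - s : ℝ) (1 - t), abs_mul,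
        abs_of_nonneg (l.2.1 e), sub_sub_sub_cancel_left, abs_sub_comm]

/-- The directions at a point in the image of the vertices. -/
abbrev VertexDirs (l : G.Cone) (p : Realization l) : Type :=
  {a : Fin G.n × Bool // 0 < l.1 a.1 ∧ pt l (.inl (endpt a.1 a.2)) = p}

theorem ray_eq {l : G.Cone} {e : Fin G.n} {b : Bool} {u y : ℝ} {s : unitInterval}
    (h : u + sgn b * (y / l.1 e) = s) : ray l e b u y = pt l (.inr (e, s)) := by
  rw [ray, h, Set.projIcc_val]

theorem ray_endCoord_zero (l : G.Cone) (e : Fin G.n) (b : Bool) :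
    ray l e b (endCoord b) 0 = pt l (.inl (endpt e b)) := by
  cases b
  · exact (ray_eq (s := 0) (by simp [endCoord])).trans (pt_src l e)
  · exact (ray_eq (s := 1) (by simp [endCoord])).trans (pt_tgt l e)

theorem exists_isStar_vertex (l : G.Cone) (v : Fin G.m) :
    ∃ ε, IsStar (pt l (.inl v)) ε fun i : VertexDirs l (pt l (.inl v)) =>
      ray l i.1.1 i.1.2 (endCoord i.1.2) := by
  obtain ⟨ε, hε, hl⟩ := exists_pos_four_mul_le l
  refine ⟨ε, ?_⟩
  have hU : Admissible l ε fun _ b => endCoord b := by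
    refine ⟨hε, fun e b => ?_, fun e b => ?_, fun e => ?_, fun e => ?_, fun e => ?_⟩
    · cases b <;> simp [endCoord]
    · cases b <;> simp [endCoord]
    all_goals
      by_cases he : l.1 e = 0
      · exact Or.inl he
      · refine Or.inr (Or.inr ?_)
        have := hl e he
        simp [endCoord]
        linarith
  refine hU.isStar (d := Subtype.val) Subtype.val_injective (fun i => ?_) (fun i => ?_) fun x hx => ?_
  · obtain ⟨⟨e, b⟩, he, -⟩ := i
    have h1 : 2 * ε / l.1 e ≤ 1 := by rw [div_le_one he]; linarith [hl e he.ne']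
    have h2 : 0 ≤ 2 * ε / l.1 e := by positivity
    refine ⟨he, ?_⟩
    cases b <;> constructor <;> simp [endCoord] <;> linarith
  · rw [ray_endCoord_zero]
    exact i.2.2
  · obtain ⟨y, rfl⟩ := pt_surjective l x
    have h1 := (isLipschitz_vertexDist (pt l (.inl v)) hε hl).abs_sub_le zero_le_one y (.inl v)
    have h2 : vertexDist l (pt l (.inl v)) ε (.inl v) = 0 := by simp [vertexDist]
    rw [h2, sub_zero, one_mul] at h1
    have h3 := (le_abs_self _).trans_lt (h1.trans_lt hx)
    rcases y with w | ⟨e, s⟩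
    · simp only [vertexDist] at h3
      split_ifs at h3 with h
      · exact Or.inl h
      · exact absurd h3 (lt_irrefl _)
    · simp only [vertexDist, min_lt_iff, lt_irrefl, or_false] at h3
      by_cases he : l.1 e = 0
      · rw [pt_edge_of_eq_zero he]
        left
        rw [← pt_src_eq_pt_tgt he, he] at h3
        split_ifs at h3 with h
        · exact h
        · simp at h3
      · have hpos := (l.2.1 e).lt_of_ne' he
        right
        rcases h3 with h3 | h3
        · have h0 := mul_nonneg hpos.le s.2.1
          split_ifs at h3 with h
          · refine ⟨⟨(e, false), hpos, h⟩, l.1 e * s, ⟨h0, by linarith⟩, ray_eq ?_⟩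
            simp [endCoord, mul_div_cancel_left₀ _ he]
          · linarith
        · have h0 := mul_nonneg hpos.le (sub_nonneg.2 s.2.2)
          split_ifs at h3 with h
          · refine ⟨⟨(e, true), hpos, h⟩, l.1 e * (1 - s), ⟨h0, by linarith⟩, ray_eq ?_⟩
            simp [endCoord, mul_div_cancel_left₀ _ he]
          · linarith

/-- The distance from the point of the edge `e` with coordinate `u`, cut off at a small `ε`. -/
noncomputable def edgeDist (l : G.Cone) (e : Fin G.n) (u ε : ℝ) : Model G → ℝ
  | .inl _ => ε
  | .inr (e', s) => if e' = e then min (l.1 e * |(s : ℝ) - u|) ε else ε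

theorem isLipschitz_edgeDist {l : G.Cone} {e : Fin G.n} {u ε : ℝ} (h0 : ε ≤ l.1 e * u)
    (h1 : ε ≤ l.1 e * (1 - u)) (hu : u ∈ Set.Icc (0 : ℝ) 1) :
    IsLipschitz l 1 (edgeDist l e u ε) := by
  refine ⟨fun e' => ?_, fun e' => ?_, fun e' s t => ?_⟩
  · simp only [edgeDist, Set.Icc.coe_zero, zero_sub, abs_neg, abs_of_nonneg hu.1, min_eq_right h0,
      ite_self]
  · simp only [edgeDist, Set.Icc.coe_one, abs_of_nonneg (sub_nonneg.2 hu.2), min_eq_right h1,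
      ite_self]
  · simp only [edgeDist, one_mul]
    split_ifs with h
    · subst h
      refine (abs_min_sub_min_right_le _ _ _).trans ?_
      rw [← mul_sub (l.1 e') |(s : ℝ) - u| |(t : ℝ) - u|, abs_mul, abs_of_nonneg (l.2.1 e')]
      refine mul_le_mul_of_nonneg_left ?_ (l.2.1 e')
      simpa using abs_abs_sub_abs_le_abs_sub ((s : ℝ) - u) (t - u)
    · simpa using mul_nonneg (l.2.1 e') (abs_nonneg _)

theorem exists_pos_two_mul_le {l : G.Cone} {e : Fin G.n} (hl : 0 < l.1 e) {u : ℝ}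
    (hu : u ∈ Set.Ioo (0 : ℝ) 1) : ∃ ε > 0, 2 * ε ≤ l.1 e * u ∧ 2 * ε ≤ l.1 e * (1 - u) := by
  have h1 := mul_pos hl hu.1
  have h2 := mul_pos hl (sub_pos.2 hu.2)
  refine ⟨min (l.1 e * u) (l.1 e * (1 - u)) / 2, half_pos (lt_min h1 h2), ?_, ?_⟩
  · rw [mul_div_cancel₀ _ two_ne_zero]; exact min_le_left _ _
  · rw [mul_div_cancel₀ _ two_ne_zero]; exact min_le_right _ _

theorem eq_of_edgeDist_lt {l : G.Cone} {e : Fin G.n} {u : unitInterval} {ε : ℝ} {x : Model G}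
    (h : edgeDist l e u ε x < ε) : ∃ s : unitInterval, x = .inr (e, s) ∧
      l.1 e * |(s : ℝ) - u| < ε ∧ edgeDist l e u ε x = l.1 e * |(s : ℝ) - u| := by
  rcases x with w | ⟨e', s⟩
  · exact absurd h (lt_irrefl _)
  · simp only [edgeDist] at h ⊢
    split_ifs at h ⊢ with he
    · subst he
      have h' := (min_lt_iff.1 h).resolve_right (lt_irrefl _)
      exact ⟨s, rfl, h', min_eq_left h'.le⟩
    · exact absurd h (lt_irrefl _)

/-- The cut-off distance `edgeDist` is Lipschitz and vanishes only at this label, so no gluing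
occurs at inner points of edges of positive length. -/
theorem eq_of_pt_eq_pt_edge {l : G.Cone} {e : Fin G.n} (hl : 0 < l.1 e) {u : unitInterval}
    (hu : (u : ℝ) ∈ Set.Ioo (0 : ℝ) 1) {x : Model G} (h : pt l x = pt l (.inr (e, u))) :
    x = .inr (e, u) := by
  obtain ⟨ε, hε, h1, h2⟩ := exists_pos_two_mul_le hl hu
  have h3 := (isLipschitz_edgeDist (l := l) (e := e) (u := u) (ε := ε) (by linarith) (by linarith)
    ⟨hu.1.le, hu.2.le⟩).abs_sub_le zero_le_one x (.inr (e, u))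
  have h4 : edgeDist l e u ε (.inr (e, u)) = 0 := by simp [edgeDist, hε.le]
  rw [h, dist_self, mul_zero, h4, sub_zero, abs_nonpos_iff] at h3
  obtain ⟨s, rfl, -, h5⟩ := eq_of_edgeDist_lt (h3.trans_lt hε)
  rw [h3, eq_comm, mul_eq_zero, abs_eq_zero, sub_eq_zero] at h5
  rw [Subtype.ext (h5.resolve_left hl.ne')]

theorem exists_isStar_edge {l : G.Cone} {e : Fin G.n} (hl : 0 < l.1 e) {u : unitInterval}
    (hu : (u : ℝ) ∈ Set.Ioo (0 : ℝ) 1) :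
    ∃ ε, IsStar (pt l (.inr (e, u))) ε fun b : Bool => ray l e b u := by
  obtain ⟨ε, hε, h1, h2⟩ := exists_pos_two_mul_le hl hu
  refine ⟨ε, ?_⟩
  -- On the other edges each direction starts at the end where it leads out of the edge, so there
  -- are no tents there.
  have hU : Admissible l ε fun e' b => if e' = e then (u : ℝ) else endCoord !b := by
    refine ⟨hε, fun e' b => ?_, fun e' b => ?_, fun e' => ?_, fun e' => ?_, fun e' => ?_⟩
    · split_ifs
      · exact hu.1.le
      · cases b <;> simp [endCoord]
    · split_ifs
      · exact hu.2.le
      · cases b <;> simp [endCoord]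
    all_goals
      by_cases he : e' = e
      · subst he
        simp [h1, h2]
      · simp [he, endCoord]
  have h0 : ∀ b, ray l e b u 0 = pt l (.inr (e, u)) := fun b => ray_eq (by simp)
  have := hU.isStar (p := pt l (.inr (e, u))) (d := fun b : Bool => (e, b)) (fun b b' h => by simpa using h)
    (fun b => ?_) (fun b => ?_) fun x hx => ?_
  · simpa only [if_true] using this
  · simp only [if_true]
    have h1' : 2 * ε / l.1 e ≤ u := by rwa [div_le_iff₀' hl]
    have h2' : 2 * ε / l.1 e ≤ 1 - u := by rwa [div_le_iff₀' hl]
    have h3' : 0 ≤ 2 * ε / l.1 e := by positivity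
    refine ⟨hl, ?_⟩
    cases b <;> constructor <;> simp <;> linarith [hu.1, hu.2]
  · simp only [if_true, h0]
  · simp only [if_true]
    obtain ⟨y, rfl⟩ := pt_surjective l x
    have h3 := (isLipschitz_edgeDist (l := l) (e := e) (u := u) (ε := ε) (by linarith)
      (by linarith) ⟨hu.1.le, hu.2.le⟩).abs_sub_le zero_le_one y (.inr (e, u))
    have h4 : edgeDist l e u ε (.inr (e, u)) = 0 := by simp [edgeDist, hε.le]
    rw [h4, sub_zero, one_mul] at h3
    obtain ⟨s, rfl, h5, -⟩ := eq_of_edgeDist_lt ((le_abs_self _).trans_lt (h3.trans_lt hx))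
    right
    rcases le_total (u : ℝ) s with h | h
    · rw [abs_of_nonneg (sub_nonneg.2 h)] at h5
      refine ⟨false, l.1 e * (s - u), ⟨mul_nonneg hl.le (sub_nonneg.2 h), h5.le⟩, ray_eq ?_⟩
      simp [mul_div_cancel_left₀ _ hl.ne']
    · rw [abs_sub_comm, abs_of_nonneg (sub_nonneg.2 h)] at h5
      refine ⟨true, l.1 e * (u - s), ⟨mul_nonneg hl.le (sub_nonneg.2 h), h5.le⟩, ray_eq ?_⟩
      simp [mul_div_cancel_left₀ _ hl.ne']

/-! ### Labels of the same point -/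

/-- Potentials with all vertex values zero: a formal slope may sit on a contracted edge, or be
cancelled immediately by a point at the start of an edge. -/
theorem isPotential_single_sub_single {l : G.Cone} {x y : Model G} {m : Fin G.n → ℤ}
    (h1 : ∀ e, l.1 e * (m e - (ramp e 1 x - ramp e 1 y)) = 0)
    (h2 : ∀ v, onVertex v x - onVertex v y =
      boundary (fun e => m e - (onEdge e x - onEdge e y)) m v) :
    Finsupp.single x 1 - Finsupp.single y 1 ∈ principalDivisors l := by
  refine ⟨0, m, fun e => ?_, fun v => ?_⟩
  · simp [h1 e]
  · simpa using h2 v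

theorem single_src_sub_mem (l : G.Cone) (e : Fin G.n) :
    Finsupp.single (.inr (e, 0)) 1 - Finsupp.single (.inl (G.src e)) 1 ∈ principalDivisors l := by
  refine isPotential_single_sub_single (m := Pi.single e 1) (fun e' => ?_) fun v => ?_
  · by_cases h : e = e'
    · subst h; simp [ramp]
    · simp [ramp, h]
  · simp [boundary, onVertex, onEdge, Pi.single_apply, eq_comm]
    rw [Finset.sum_eq_single e]
    · simp
    · intro e' _ he'
      simp [he'.symm]
    · simp

theorem single_tgt_sub_mem (l : G.Cone) (e : Fin G.n) :
    Finsupp.single (.inr (e, 1)) 1 - Finsupp.single (.inl (G.tgt e)) 1 ∈ principalDivisors l := by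
  refine isPotential_single_sub_single (m := 0) (fun e' => ?_) fun v => ?_
  · by_cases h : e = e'
    · subst h; simp [ramp]
    · simp [ramp, h]
  · simp [boundary, onVertex, onEdge]
    rw [Finset.sum_eq_single e]
    · simp only [if_true]; split_ifs <;> rfl
    · intro e' _ he'
      simp [he'.symm]
    · simp

theorem single_edge_sub_mem {l : G.Cone} {e : Fin G.n} (he : l.1 e = 0) (s : unitInterval) :
    Finsupp.single (.inr (e, s)) 1 - Finsupp.single (.inl (G.src e)) 1 ∈ principalDivisors l := by
  refine isPotential_single_sub_single (m := Pi.single e 1) (fun e' => ?_) fun v => ?_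
  · by_cases h : e = e'
    · subst h; simp [he]
    · simp [ramp, h]
  · simp [boundary, onVertex, onEdge, Pi.single_apply, eq_comm]
    rw [Finset.sum_eq_single e]
    · simp
    · intro e' _ he'
      simp [he'.symm]
    · simp

theorem single_sub_single_mem_trans {l : G.Cone} {x y z : Model G}
    (h : Finsupp.single x 1 - Finsupp.single y 1 ∈ principalDivisors l)
    (h' : Finsupp.single y 1 - Finsupp.single z 1 ∈ principalDivisors l) :
    Finsupp.single x 1 - Finsupp.single z 1 ∈ principalDivisors l := by
  simpa using add_mem h h'

theorem single_sub_single_mem_symm {l : G.Cone} {x y : Model G}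
    (h : Finsupp.single x 1 - Finsupp.single y 1 ∈ principalDivisors l) :
    Finsupp.single y 1 - Finsupp.single x 1 ∈ principalDivisors l := by
  simpa using neg_mem h

theorem single_src_sub_tgt_mem {l : G.Cone} {e : Fin G.n} (he : l.1 e = 0) :
    Finsupp.single (.inl (G.src e)) 1 - Finsupp.single (.inl (G.tgt e)) 1 ∈
      principalDivisors l :=
  single_sub_single_mem_trans (single_sub_single_mem_symm (single_edge_sub_mem he 1))
    (single_tgt_sub_mem l e)

/-- The indicator of the vertices equivalent to `u` is constant along contracted edges. Interpolated
linearly, it is Lipschitz, so it cannot separate vertices at distance zero. -/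
theorem single_vertex_sub_mem {l : G.Cone} {u v : Fin G.m}
    (h : pt l (.inl u) = pt l (.inl v)) :
    Finsupp.single (.inl u) 1 - Finsupp.single (.inl v) 1 ∈ principalDivisors l := by
  classical
  obtain ⟨ε, hε, hl⟩ := exists_pos_four_mul_le l
  let χ : Fin G.m → ℝ := fun w =>
    if Finsupp.single (.inl u) 1 - Finsupp.single (.inl w) 1 ∈ principalDivisors l then 1 else 0
  have hχ : ∀ a b, |χ a - χ b| ≤ 1 := fun a b => by
    simp only [χ]
    split_ifs <;> simp
  let F : Model G → ℝ
    | .inl w => χ w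
    | .inr (e, s) => χ (G.src e) + s * (χ (G.tgt e) - χ (G.src e))
  have hF : IsLipschitz l ε⁻¹ F := by
    refine ⟨fun e => by simp [F], fun e => by simp [F], fun e s t => ?_⟩
    simp only [F]
    rw [add_sub_add_left_eq_sub, ← sub_mul, abs_mul]
    by_cases he : l.1 e = 0
    · have : χ (G.tgt e) = χ (G.src e) := by
        simp only [χ]
        congr 1
        refine propext ⟨fun H => ?_, fun H => ?_⟩
        · exact single_sub_single_mem_trans H
            (single_sub_single_mem_symm (single_src_sub_tgt_mem he))
        · exact single_sub_single_mem_trans H (single_src_sub_tgt_mem he)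
      simp [this, he]
    · calc |(s : ℝ) - t| * |χ (G.tgt e) - χ (G.src e)| ≤ |(s : ℝ) - t| * (ε⁻¹ * l.1 e) := by
            refine mul_le_mul_of_nonneg_left ((hχ _ _).trans ?_) (abs_nonneg _)
            rw [inv_mul_eq_div, le_div_iff₀ hε]
            linarith [hl e he]
        _ = _ := by ring
  have h1 := hF.abs_sub_le (inv_nonneg.2 hε.le) (.inl u) (.inl v)
  rw [h, dist_self, mul_zero, abs_nonpos_iff, sub_eq_zero] at h1
  by_contra hne
  simp [F, χ, hne] at h1

/-- The labels that are vertices, or inner points of edges of positive length. -/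
def IsNormal (l : G.Cone) : Model G → Prop
  | .inl _ => True
  | .inr (e, u) => 0 < l.1 e ∧ (u : ℝ) ∈ Set.Ioo (0 : ℝ) 1

theorem exists_isNormal (l : G.Cone) (x : Model G) : ∃ y, IsNormal l y ∧ pt l y = pt l x ∧
    Finsupp.single x 1 - Finsupp.single y 1 ∈ principalDivisors l := by
  rcases x with v | ⟨e, u⟩
  · exact ⟨.inl v, trivial, rfl, by simp⟩
  rcases (l.2.1 e).eq_or_lt with he | he
  · exact ⟨.inl (G.src e), trivial, (pt_edge_of_eq_zero he.symm u).symm,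
      single_edge_sub_mem he.symm u⟩
  rcases u.2.1.eq_or_lt with h0 | h0
  · rw [show u = 0 from Subtype.ext h0.symm]
    exact ⟨.inl (G.src e), trivial, (pt_src l e).symm, single_src_sub_mem l e⟩
  rcases u.2.2.eq_or_lt with h1 | h1
  · rw [show u = 1 from Subtype.ext h1]
    exact ⟨.inl (G.tgt e), trivial, (pt_tgt l e).symm, single_tgt_sub_mem l e⟩
  · exact ⟨.inr (e, u), ⟨he, h0, h1⟩, rfl, by simp⟩

theorem single_sub_single_mem {l : G.Cone} {x y : Model G} (h : pt l x = pt l y) :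
    Finsupp.single x 1 - Finsupp.single y 1 ∈ principalDivisors l := by
  obtain ⟨x', hx, hx', hxx⟩ := exists_isNormal l x
  obtain ⟨y', hy, hy', hyy⟩ := exists_isNormal l y
  refine single_sub_single_mem_trans hxx
    (single_sub_single_mem_trans ?_ (single_sub_single_mem_symm hyy))
  have h' : pt l x' = pt l y' := by rw [hx', hy', h]
  rcases y' with v | ⟨e, u⟩
  · rcases x' with w | ⟨e, u⟩
    · exact single_vertex_sub_mem h'
    · have := eq_of_pt_eq_pt_edge hx.1 hx.2 h'.symm
      simp at this
  · rw [eq_of_pt_eq_pt_edge hy.1 hy.2 h', sub_self]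
    exact zero_mem _

/-- Replacing every label by a chosen one for the same point changes a divisor by a principal one
and depends only on its image. -/
theorem sub_mem_of_mapDomain_eq {l : G.Cone} {D D' : Model G →₀ ℤ}
    (h : D.mapDomain (pt l) = D'.mapDomain (pt l)) : D - D' ∈ principalDivisors l := by
  have hinv := Function.surjInv_eq (pt_surjective l)
  set ρ := Function.surjInv (pt_surjective l)
  have key : ∀ D : Model G →₀ ℤ, D - (D.mapDomain (pt l)).mapDomain ρ ∈ principalDivisors l := by
    intro D
    induction D using Finsupp.induction_linear with
    | zero => simp
    | add D D' h h' =>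
      rw [Finsupp.mapDomain_add, Finsupp.mapDomain_add, add_sub_add_comm]
      exact add_mem h h'
    | single x a =>
      rw [Finsupp.mapDomain_single, Finsupp.mapDomain_single]
      have := zsmul_mem (single_sub_single_mem (hinv (pt l x)).symm) a
      simpa [smul_sub] using this
  have h1 := sub_mem (key D) (key D')
  rwa [h, sub_sub_sub_cancel_right] at h1

theorem exists_isNormal_mapDomain_eq (l : G.Cone) (D : Model G →₀ ℤ) :
    ∃ D' : Model G →₀ ℤ, (∀ x ∈ D'.support, IsNormal l x) ∧
      D'.mapDomain (pt l) = D.mapDomain (pt l) := by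
  classical
  choose ν hν hν' _ using exists_isNormal l
  refine ⟨D.mapDomain ν, fun x hx => ?_, ?_⟩
  · obtain ⟨y, -, rfl⟩ := Finset.mem_image.1 (Finsupp.mapDomain_support hx)
    exact hν y
  · rw [← Finsupp.mapDomain_comp]
    congr 1
    exact funext hν'

/-! ### Totals of divisors -/

theorem total_congr {X M : Type*} [AddCommGroup M] {g g' : X → M} {D : X →₀ ℤ}
    (h : ∀ x ∈ D.support, g x = g' x) : total g D = total g' D := by
  simp only [Finsupp.linearCombination_apply]
  exact Finsupp.sum_congr fun x hx => by rw [h x hx]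

theorem total_sub_left {X M : Type*} [AddCommGroup M] (g g' : X → M) (D : X →₀ ℤ) :
    total (fun x => g x - g' x) D = total g D - total g' D := by
  simp [Finsupp.linearCombination_apply, Finsupp.sum, smul_sub]

theorem total_indicator {X : Type*} [DecidableEq X] (a : X) (D : X →₀ ℤ) :
    total (fun x => if x = a then (1 : ℤ) else 0) D = D a := by
  induction D using Finsupp.induction_linear with
  | zero => simp
  | add D D' h h' => simp [h, h']
  | single x b => simp [Finsupp.single_apply]

open Classical in
theorem mapDomain_apply_eq_total {X Y : Type*} (f : X → Y) (D : X →₀ ℤ) (y : Y) :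
    D.mapDomain f y = total (fun x => if f x = y then (1 : ℤ) else 0) D := by
  induction D using Finsupp.induction_linear with
  | zero => simp
  | add D D' h h' => simp [Finsupp.mapDomain_add, h, h']
  | single x b => simp [Finsupp.single_apply]

theorem mapDomain_pt_edge {l : G.Cone} {e : Fin G.n} (hl : 0 < l.1 e) {u : unitInterval}
    (hu : (u : ℝ) ∈ Set.Ioo (0 : ℝ) 1) (D : Model G →₀ ℤ) :
    D.mapDomain (pt l) (pt l (.inr (e, u))) = D (.inr (e, u)) := by
  classical
  rw [mapDomain_apply_eq_total, ← total_indicator]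
  refine total_congr fun x _ => if_congr ⟨eq_of_pt_eq_pt_edge hl hu, fun h => by rw [h]⟩ rfl rfl

-- Labels on edges are inner points of edges of positive length here, so only vertices can
-- contribute to the fibre over a vertex.
open Classical in
theorem mapDomain_pt_vertex {l : G.Cone} {D : Model G →₀ ℤ} (hD : ∀ x ∈ D.support, IsNormal l x)
    (v : Fin G.m) : D.mapDomain (pt l) (pt l (.inl v)) =
      ∑ w, if pt l (.inl w) = pt l (.inl v) then total (onVertex w) D else 0 := by
  rw [mapDomain_apply_eq_total, total_congr (g' := fun x =>
    ∑ w, if pt l (.inl w) = pt l (.inl v) then onVertex w x else 0)]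
  · simp only [Finsupp.linearCombination_apply, Finsupp.sum, Finset.smul_sum]
    rw [Finset.sum_comm]
    refine Finset.sum_congr rfl fun w _ => ?_
    split_ifs <;> simp
  · rintro (w | ⟨e, u⟩) hx
    · simp only [onVertex]
      rw [Finset.sum_eq_single w]
      · simp
      · intro w' _ hw
        simp [hw.symm]
      · simp
    · have hn := hD _ hx
      rw [if_neg fun h => ?_]
      · simp [onVertex]
      · have := eq_of_pt_eq_pt_edge hn.1 hn.2 h.symm
        simp at this

/-- The indicator function of the points of the edge `e` with coordinate at most `u`, or less than
`u` if `b` is true. -/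
noncomputable def below (e : Fin G.n) (b : Bool) (u : ℝ) : Model G → ℤ
  | .inl _ => 0
  | .inr (e', w) => if e' = e ∧ (if b then (w : ℝ) < u else (w : ℝ) ≤ u) then 1 else 0

/-- One-sided derivatives in the cut-off: points at `u` count when it moves right, not when it moves
left. The jump, `total_below_sub`, is the coefficient of `D`. -/
theorem eventually_total_ramp (e : Fin G.n) (b : Bool) (u : ℝ) (D : Model G →₀ ℤ) :
    ∀ᶠ z in 𝓝[>] (0 : ℝ), total (ramp e (u + sgn b * z)) D =
      total (ramp e u) D + sgn b * z * total (below e b u) D := by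
  induction D using Finsupp.induction_linear with
  | zero => simp
  | add D D' h h' =>
    filter_upwards [h, h'] with z h h'
    simp only [map_add, h, h', Int.cast_add]
    ring
  | single x a =>
    have key : ∀ᶠ z in 𝓝[>] (0 : ℝ),
        ramp e (u + sgn b * z) x = ramp e u x + sgn b * z * below e b u x := by
      rcases x with v | ⟨e', w⟩
      · exact Eventually.of_forall fun z => by simp [ramp, below]
      by_cases he : e' = e
      swap
      · exact Eventually.of_forall fun z => by simp [ramp, below, he]
      subst he
      rcases lt_trichotomy (w : ℝ) u with h | h | h
      · filter_upwards [Ioc_mem_nhdsGT (sub_pos.2 h)] with z hz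
        have h1 : (w : ℝ) ≤ u := h.le
        cases b
        · simp only [ramp, below, if_true, sgn_false, true_and, Bool.false_eq_true, if_false, h1]
          rw [max_eq_left (by simp; linarith [hz.1]), max_eq_left (by linarith)]
          push_cast; ring
        · simp only [ramp, below, if_true, sgn_true, true_and, h]
          rw [max_eq_left (by simp; linarith [hz.2]), max_eq_left (by linarith)]
          push_cast; ring
      · filter_upwards [self_mem_nhdsWithin] with z hz
        have hz : 0 < z := hz
        cases b <;> simp [ramp, below, h, hz.le]
      · filter_upwards [Ioc_mem_nhdsGT (sub_pos.2 h)] with z hz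
        have h1 : ¬ (w : ℝ) ≤ u := not_le.2 h
        have h2 : ¬ (w : ℝ) < u := not_lt.2 h.le
        cases b
        · simp only [ramp, below, if_true, sgn_false, true_and, Bool.false_eq_true, if_false, h1]
          rw [max_eq_right (by simp; linarith [hz.2]), max_eq_right (by linarith)]
          simp
        · simp only [ramp, below, if_true, sgn_true, true_and, h2, if_false]
          rw [max_eq_right (by simp; linarith [hz.1]), max_eq_right (by linarith)]
          simp
    filter_upwards [key] with z hz
    simp only [Finsupp.linearCombination_single, hz, zsmul_eq_mul]
    push_cast
    ring

theorem total_below_sub (e : Fin G.n) (u : unitInterval) (D : Model G →₀ ℤ) :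
    total (below e false u) D - total (below e true u) D = D (.inr (e, u)) := by
  classical
  rw [← total_sub_left, ← total_indicator]
  refine total_congr fun x _ => ?_
  rcases x with v | ⟨e', w⟩
  · simp [below]
  · by_cases he : e' = e
    · subst he
      rcases lt_trichotomy w u with h | h | h
      · simp [below, h, h.le, h.ne]
      · simp [below, h]
      · simp [below, not_lt.2 h.le, not_le.2 h, h.ne']
    · simp [below, he]

theorem total_below_zero {l : G.Cone} {D : Model G →₀ ℤ} (hD : ∀ x ∈ D.support, IsNormal l x)
    (e : Fin G.n) : total (below e false 0) D = 0 := by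
  rw [total_congr (g' := fun _ => 0)]
  · simp [Finsupp.linearCombination_apply]
  · rintro (v | ⟨e', w⟩) hx
    · rfl
    · have := (hD _ hx).2.1
      simp only [below]
      rw [if_neg]
      simp [this]

theorem total_below_one {l : G.Cone} {D : Model G →₀ ℤ} (hD : ∀ x ∈ D.support, IsNormal l x)
    (e : Fin G.n) : total (below e true 1) D = total (onEdge e) D := by
  refine total_congr ?_
  rintro (v | ⟨e', w⟩) hx
  · rfl
  · have := (hD _ hx).2.2
    simp [below, onEdge, this]

theorem total_onEdge_of_eq_zero {l : G.Cone} {D : Model G →₀ ℤ}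
    (hD : ∀ x ∈ D.support, IsNormal l x) {e : Fin G.n} (he : l.1 e = 0) :
    total (onEdge e) D = 0 := by
  rw [total_congr (g' := fun _ => 0)]
  · simp [Finsupp.linearCombination_apply]
  · rintro (v | ⟨e', w⟩) hx
    · rfl
    · have := (hD _ hx).1
      simp only [onEdge]
      rw [if_neg]
      rintro rfl
      exact this.ne' he

/-! ### Germs of affine functions -/

theorem affine_germ_unique {a b a' b' : ℝ}
    (h : ∀ᶠ z in 𝓝[>] (0 : ℝ), a + b * z = a' + b' * z) : a = a' ∧ b = b' := by
  have ht : ∀ a b : ℝ, Tendsto (fun z => a + b * z) (𝓝[>] 0) (𝓝 a) := fun a b => by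
    have : Tendsto (fun z : ℝ => a + b * z) (𝓝 0) (𝓝 (a + b * 0)) :=
      (by fun_prop : Continuous fun z : ℝ => a + b * z).tendsto 0
    rw [mul_zero, add_zero] at this
    exact this.mono_left nhdsWithin_le_nhds
  have ha : a = a' := tendsto_nhds_unique_of_eventuallyEq (ht a b) (ht a' b') h
  obtain ⟨z, hz, hz0⟩ := (h.and self_mem_nhdsWithin).exists
  have hz0 : 0 < z := hz0
  subst ha
  exact ⟨rfl, mul_right_cancel₀ hz0.ne' (add_left_cancel hz)⟩

/-- Continuation argument: at the supremum `τ` of the affine range, the left germ fixes value and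
slope, and the equal right slope would carry the formula past `τ < 1`. -/
theorem affine_of_locally_affine {φ : ℝ → ℝ} {c₀ c₁ : ℝ}
    (h0 : ∀ᶠ z in 𝓝[>] (0 : ℝ), φ z = φ 0 + c₀ * z)
    (h1 : ∀ᶠ z in 𝓝[>] (0 : ℝ), φ (1 - z) = φ 1 + c₁ * z)
    (h : ∀ u ∈ Set.Ioo (0 : ℝ) 1, ∃ c, (∀ᶠ z in 𝓝[>] (0 : ℝ), φ (u + z) = φ u + c * z) ∧
      ∀ᶠ z in 𝓝[>] (0 : ℝ), φ (u - z) = φ u - c * z) :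
    φ 1 = φ 0 + c₀ ∧ c₁ = -c₀ := by
  set T : Set ℝ := {t | t ∈ Set.Icc (0 : ℝ) 1 ∧ ∀ s ∈ Set.Icc 0 t, φ s = φ 0 + c₀ * s} with hT
  have h0T : (0 : ℝ) ∈ T := ⟨⟨le_rfl, zero_le_one⟩, fun s hs => by
    rw [le_antisymm hs.2 hs.1]; ring⟩
  have hbdd : BddAbove T := ⟨1, fun t ht => ht.1.2⟩
  set τ := sSup T
  have hτ0 : 0 ≤ τ := le_csSup hbdd h0T
  have hτ1 : τ ≤ 1 := csSup_le ⟨0, h0T⟩ fun t ht => ht.1.2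
  have hlt : ∀ s ∈ Set.Ico 0 τ, φ s = φ 0 + c₀ * s := fun s hs => by
    obtain ⟨t, ht, hst⟩ := exists_lt_of_lt_csSup ⟨0, h0T⟩ hs.2
    exact ht.2 s ⟨hs.1, hst.le⟩
  have hleft : 0 < τ → ∀ c, (∀ᶠ z in 𝓝[>] (0 : ℝ), φ (τ - z) = φ τ + c * z) →
      φ τ = φ 0 + c₀ * τ ∧ c = -c₀ := fun hpos c hc => by
    refine affine_germ_unique ?_
    filter_upwards [hc, Ioc_mem_nhdsGT hpos] with z hz hz'
    rw [← hz, hlt _ ⟨by linarith [hz'.2], by linarith [hz'.1]⟩]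
    ring
  have hcontra : τ < 1 → φ τ = φ 0 + c₀ * τ →
      (∀ᶠ z in 𝓝[>] (0 : ℝ), φ (τ + z) = φ τ + c₀ * z) → False := fun hτ hφ hc => by
    obtain ⟨δ, hδ, hδ'⟩ := mem_nhdsGT_iff_exists_Ioc_subset.1 hc
    have hδ : 0 < δ := hδ
    set η := min δ (1 - τ)
    have hη : 0 < η := lt_min hδ (sub_pos.2 hτ)
    have hmem : τ + η ∈ T := by
      refine ⟨⟨by linarith, by linarith [min_le_right δ (1 - τ)]⟩, fun s hs => ?_⟩
      rcases lt_trichotomy s τ with h | h | h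
      · exact hlt s ⟨hs.1, h⟩
      · rw [h, hφ]
      · have : φ (τ + (s - τ)) = φ τ + c₀ * (s - τ) :=
          hδ' ⟨by linarith, by linarith [hs.2, min_le_left δ (1 - τ)]⟩
        rw [add_sub_cancel] at this
        rw [this, hφ]
        ring
    linarith [le_csSup hbdd hmem]
  rcases hτ0.eq_or_lt with h2 | h2
  · exact (hcontra (by rw [← h2]; exact zero_lt_one) (by rw [← h2]; ring)
      (by rw [← h2]; simpa using h0)).elim
  rcases hτ1.eq_or_lt with h3 | h3
  · rw [h3] at hleft
    simpa using hleft zero_lt_one c₁ h1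
  · obtain ⟨c, hc1, hc2⟩ := h τ ⟨h2, h3⟩
    obtain ⟨h4, h5⟩ := hleft h2 (-c) (by simpa [sub_eq_add_neg] using hc2)
    rw [neg_inj.1 h5] at hc1
    exact (hcontra h3 h4 hc1).elim

theorem eventually_mem_of_direction {b : Bool} {u : ℝ} (hu : u ∈ Set.Icc (0 : ℝ) 1)
    (h0 : b = false → u < 1) (h1 : b = true → 0 < u) :
    ∀ᶠ z in 𝓝[>] (0 : ℝ), u + sgn b * z ∈ Set.Icc (0 : ℝ) 1 := by
  cases b
  · filter_upwards [Ioc_mem_nhdsGT (sub_pos.2 (h0 rfl))] with z hz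
    constructor <;> simp <;> linarith [hz.1, hz.2, hu.1]
  · filter_upwards [Ioc_mem_nhdsGT (h1 rfl)] with z hz
    constructor <;> simp <;> linarith [hz.1, hz.2, hu.2]

theorem tendsto_mul_nhdsGT_zero {c : ℝ} (hc : 0 < c) :
    Tendsto (fun z => c * z) (𝓝[>] 0) (𝓝[>] 0) := by
  refine tendsto_nhdsWithin_iff.2 ⟨?_, ?_⟩
  · have : Tendsto (fun z : ℝ => c * z) (𝓝 0) (𝓝 (c * 0)) :=
      (by fun_prop : Continuous fun z : ℝ => c * z).tendsto 0
    rw [mul_zero] at this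
    exact this.mono_left nhdsWithin_le_nhds
  · filter_upwards [self_mem_nhdsWithin] with z hz using mul_pos hc hz

/-! ### Balancing at the vertices -/

-- Vertices with the same image are balanced together. A contracted edge has both ends in the same
-- fibre, so its arbitrary slope cancels, while the other edges contribute one term for each
-- direction at `p`.
open Classical in
theorem sum_boundary_eq {l : G.Cone} (p : Realization l) {m c : Fin G.n → ℤ}
    (hc : ∀ e, l.1 e = 0 → c e = 0) :
    ∑ v, (if pt l (.inl v) = p then boundary (fun e => m e - c e) m v else 0) =
      -∑ i : VertexDirs l p, (if i.1.2 then -(m i.1.1 - c i.1.1) else m i.1.1) := by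
  have hL : ∑ v, (if pt l (.inl v) = p then boundary (fun e => m e - c e) m v else 0) =
      ∑ e, ((if pt l (.inl (G.tgt e)) = p then m e - c e else 0) -
        if pt l (.inl (G.src e)) = p then m e else 0) := by
    simp only [boundary, ← Finset.sum_filter]
    rw [Finset.sum_sub_distrib, Finset.sum_sub_distrib]
    congr 1 <;>
    · simp only [Finset.sum_filter]
      simp only [← Finset.sum_filter (p := fun v => pt l (.inl v) = p)]
      rw [Finset.sum_comm]
      refine Finset.sum_congr rfl fun e _ => ?_
      simp
  have hR : ∑ i : VertexDirs l p, (if i.1.2 then -(m i.1.1 - c i.1.1) else m i.1.1) =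
      ∑ a : Fin G.n × Bool, if 0 < l.1 a.1 ∧ pt l (.inl (endpt a.1 a.2)) = p then
        (if a.2 then -(m a.1 - c a.1) else m a.1) else 0 := by
    rw [← Finset.sum_filter]
    exact (Finset.sum_subtype
      (Finset.univ.filter fun a : Fin G.n × Bool => 0 < l.1 a.1 ∧ pt l (.inl (endpt a.1 a.2)) = p)
      (fun a => by simp) fun a => if a.2 then -(m a.1 - c a.1) else m a.1).symm
  rw [hL, hR, Fintype.sum_prod_type, ← Finset.sum_neg_distrib]
  refine Finset.sum_congr rfl fun e _ => ?_
  rw [Fintype.sum_bool]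
  rcases (l.2.1 e).eq_or_lt with he | he
  · rw [hc e he.symm, pt_src_eq_pt_tgt he.symm]
    simp [← he]
  · simp only [endpt, he, true_and, if_true, Bool.false_eq_true, if_false]
    split_ifs <;> ring

/-! ### Comparison with the realization -/

theorem abs_total_ramp_sub_le (e : Fin G.n) (D : Model G →₀ ℤ) (s t : ℝ) :
    |total (ramp e s) D - total (ramp e t) D| ≤ (∑ x ∈ D.support, |(D x : ℝ)|) * |s - t| := by
  rw [← total_sub_left, Finsupp.linearCombination_apply, Finsupp.sum, Finset.sum_mul]
  refine (Finset.abs_sum_le_sum_abs _ _).trans (Finset.sum_le_sum fun x _ => ?_)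
  rw [zsmul_eq_mul, abs_mul]
  refine mul_le_mul_of_nonneg_left ?_ (abs_nonneg _)
  rcases x with v | ⟨e', u⟩
  · simp [ramp]
  · simp only [ramp]
    split_ifs
    · refine (abs_max_sub_max_le_abs _ _ _).trans ?_
      rw [sub_sub_sub_cancel_right]
    · simp

theorem total_ramp_zero (e : Fin G.n) (D : Model G →₀ ℤ) : total (ramp e 0) D = 0 := by
  rw [total_congr (g' := fun _ => 0)]
  · simp [Finsupp.linearCombination_apply]
  · rintro (v | ⟨e', u⟩) _
    · rfl
    · simp [ramp, u.2.1]

/-- The function with values `h` at the vertices, initial slopes `m` and slopes changing at the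
points of `D`. -/
noncomputable def potential (l : G.Cone) (D : Model G →₀ ℤ) (h : Fin G.m → ℝ) (m : Fin G.n → ℤ) :
    Model G → ℝ
  | .inl v => h v
  | .inr (e, s) => h (G.src e) + l.1 e * (m e * s - total (ramp e s) D)

theorem IsPotential.exists_isLipschitz {l : G.Cone} {D : Model G →₀ ℤ} {h : Fin G.m → ℝ}
    {m : Fin G.n → ℤ} (H : IsPotential l D h m) :
    ∃ C, 0 ≤ C ∧ IsLipschitz l C (potential l D h m) := by
  refine ⟨∑ e, |(m e : ℝ)| + ∑ x ∈ D.support, |(D x : ℝ)|, by positivity,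
    fun e => ?_, fun e => ?_, fun e s t => ?_⟩
  · simp [potential, total_ramp_zero]
  · have := H.edge e
    simp only [potential, Set.Icc.coe_one, mul_one]
    linarith
  · simp only [potential]
    rw [show h (G.src e) + l.1 e * (m e * s - total (ramp e s) D) -
      (h (G.src e) + l.1 e * (m e * t - total (ramp e t) D)) =
      l.1 e * (m e * (s - t) - (total (ramp e s) D - total (ramp e t) D)) by ring,
      abs_mul, abs_of_nonneg (l.2.1 e), mul_left_comm]
    refine mul_le_mul_of_nonneg_left ?_ (l.2.1 e)
    refine (abs_sub _ _).trans ?_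
    rw [add_mul, abs_mul]
    refine add_le_add (mul_le_mul_of_nonneg_right ?_ (abs_nonneg _))
      (abs_total_ramp_sub_le e D s t)
    exact Finset.single_le_sum (f := fun e => |(m e : ℝ)|) (fun e _ => abs_nonneg _)
      (Finset.mem_univ e)

theorem eventually_potential_ray {l : G.Cone} {D : Model G →₀ ℤ} {h : Fin G.m → ℝ}
    {m : Fin G.n → ℤ} {f : Realization l → ℝ} (hf : ∀ x, f (pt l x) = potential l D h m x)
    {e : Fin G.n} (he : 0 < l.1 e) {b : Bool} {u : ℝ} (hu : u ∈ Set.Icc (0 : ℝ) 1)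
    (h0 : b = false → u < 1) (h1 : b = true → 0 < u) :
    ∀ᶠ y in 𝓝[>] (0 : ℝ), f (ray l e b u y) =
      f (ray l e b u 0) + (sgn b * (m e - total (below e b u) D) : ℤ) * y := by
  have ht := tendsto_mul_nhdsGT_zero (inv_pos.2 he)
  filter_upwards [ht.eventually (eventually_mem_of_direction hu h0 h1),
    ht.eventually (eventually_total_ramp e b u D)] with y hy hy'
  rw [← div_eq_inv_mul] at hy hy'
  rw [ray_eq (s := ⟨_, hy⟩) rfl, ray_eq (y := 0) (s := ⟨u, hu⟩) (by simp), hf, hf]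
  simp only [potential, hy']
  push_cast
  field_simp
  ring

/-- The potential descends to the realization by its Lipschitz property; its order is the jump of
slope inside an edge and the balance of the whole fibre at a vertex. -/
theorem isPrincipal_of_isPotential {l : G.Cone} {D : Model G →₀ ℤ} {h : Fin G.m → ℝ}
    {m : Fin G.n → ℤ} (hD : ∀ x ∈ D.support, IsNormal l x) (H : IsPotential l D h m) :
    IsPrincipal (D.mapDomain (pt l)) := by
  classical
  obtain ⟨C, hC, hF⟩ := H.exists_isLipschitz
  obtain ⟨f, hf, -⟩ := hF.exists_lift hC
  refine ⟨f, fun p => ?_⟩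
  obtain ⟨x, rfl⟩ := pt_surjective l p
  obtain ⟨x, hx, hx', -⟩ := exists_isNormal l x
  rw [← hx']
  rcases x with v | ⟨e, u⟩
  · obtain ⟨ε, hs⟩ := exists_isStar_vertex l v
    refine hs.hasOrderAt_iff.2 ⟨fun i => if i.1.2 then -(m i.1.1 - total (onEdge i.1.1) D)
      else m i.1.1, fun i => ?_, ?_⟩
    · obtain ⟨⟨e, b⟩, he, hp⟩ := i
      have := eventually_potential_ray hf he (b := b) (u := endCoord b)
        (by cases b <;> simp [endCoord]) (by rintro rfl; simp [endCoord])
        (by rintro rfl; simp [endCoord])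
      filter_upwards [this] with y hy
      rw [hy, ray_endCoord_zero, congrArg f hp]
      cases b
      · simp [endCoord, total_below_zero hD]
      · simp [endCoord, total_below_one hD]
    · rw [mapDomain_pt_vertex hD, ← sum_boundary_eq _ fun e he => total_onEdge_of_eq_zero hD he]
      exact Finset.sum_congr rfl fun w _ => by rw [H.vert]
  · obtain ⟨ε, hs⟩ := exists_isStar_edge hx.1 hx.2
    refine hs.hasOrderAt_iff.2 ⟨fun b => sgn b * (m e - total (below e b u) D), fun b => ?_, ?_⟩
    · have := eventually_potential_ray hf hx.1 (b := b) (u := u) u.2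
        (fun _ => hx.2.2) (fun _ => hx.2.1)
      rwa [ray_eq (y := 0) (s := u) (by simp)] at this
    · rw [mapDomain_pt_edge hx.1 hx.2, ← total_below_sub, Fintype.sum_bool]
      simp

theorem eventually_add_total_ramp {l : G.Cone} (D : Model G →₀ ℤ) {f : Realization l → ℝ}
    {e : Fin G.n} (he : 0 < l.1 e) {b : Bool} {u a k : ℝ}
    (hk : ∀ᶠ y in 𝓝[>] (0 : ℝ), f (ray l e b u y) = a + k * y) :
    ∀ᶠ z in 𝓝[>] (0 : ℝ),
      f (pt l (.inr (e, Set.projIcc 0 1 zero_le_one (u + sgn b * z)))) +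
        l.1 e * total (ramp e (u + sgn b * z)) D =
      a + l.1 e * total (ramp e u) D + l.1 e * (k + sgn b * total (below e b u) D) * z := by
  filter_upwards [(tendsto_mul_nhdsGT_zero he).eventually hk, eventually_total_ramp e b u D]
    with z hz hz'
  rw [ray, mul_div_cancel_left₀ _ he.ne'] at hz
  rw [hz, hz']
  ring

/-- Adding `l e * total (ramp e t) D` to `f` along `e` cancels every bend prescribed by `D`; the sum
is affine, which relates the slopes and values at the two ends. -/
theorem edge_slopes {l : G.Cone} {D : Model G →₀ ℤ} (hD : ∀ x ∈ D.support, IsNormal l x)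
    {f : Realization l → ℝ} (hf : ∀ p, HasOrderAt f p (D.mapDomain (pt l) p))
    {e : Fin G.n} (he : 0 < l.1 e) {s : Bool → ℤ}
    (hs : ∀ b, ∀ᶠ y in 𝓝[>] (0 : ℝ), f (ray l e b (endCoord b) y) =
      f (pt l (.inl (endpt e b))) + s b * y) :
    f (pt l (.inl (G.tgt e))) - f (pt l (.inl (G.src e))) =
      l.1 e * (s false - total (ramp e 1) D) ∧ s true = -(s false - total (onEdge e) D) := by
  set φ : ℝ → ℝ := fun t => f (pt l (.inr (e, Set.projIcc 0 1 zero_le_one t))) +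
    l.1 e * total (ramp e t) D with hφ
  have hφ0 : φ 0 = f (pt l (.inl (G.src e))) := by
    simp only [hφ, Set.projIcc_left, total_ramp_zero, mul_zero, add_zero]
    exact congrArg f (pt_src l e)
  have hφ1 : φ 1 = f (pt l (.inl (G.tgt e))) + l.1 e * total (ramp e 1) D := by
    simp only [hφ, Set.projIcc_right]
    congr 1
    exact congrArg f (pt_tgt l e)
  have key := affine_of_locally_affine (φ := φ) (c₀ := l.1 e * s false)
    (c₁ := l.1 e * (s true - total (onEdge e) D)) ?_ ?_ ?_
  · obtain ⟨h1, h2⟩ := key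
    rw [hφ0, hφ1] at h1
    refine ⟨by linarith, ?_⟩
    rw [← mul_neg] at h2
    have h3 := mul_left_cancel₀ he.ne' h2
    have h4 : s true - total (onEdge e) D = -s false := by exact_mod_cast h3
    linarith
  · filter_upwards [eventually_add_total_ramp D he (hs false)] with z hz
    simp only [endCoord, sgn_false, Int.cast_one, one_mul, Bool.false_eq_true, if_false, zero_add,
      total_below_zero hD, total_ramp_zero, Int.cast_zero, add_zero, mul_zero] at hz
    rw [hφ0]
    exact hz
  · filter_upwards [eventually_add_total_ramp D he (hs true)] with z hz
    simp only [endCoord, sgn_true, Int.cast_one, Int.cast_neg, neg_mul, one_mul, if_true,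
      total_below_one hD] at hz
    rw [hφ1]
    exact hz
  · intro u hu
    let w : unitInterval := ⟨u, hu.1.le, hu.2.le⟩
    obtain ⟨ε, hstar⟩ := exists_isStar_edge he (u := w) hu
    obtain ⟨k, hk, hsum⟩ := hstar.hasOrderAt_iff.1 (hf (pt l (.inr (e, w))))
    rw [mapDomain_pt_edge he (u := w) hu, ← total_below_sub, Fintype.sum_bool] at hsum
    have hφu : f (pt l (.inr (e, w))) + l.1 e * total (ramp e u) D = φ u := by
      simp only [hφ]
      rw [Set.projIcc_of_mem _ w.2]
    have hsum' : (k true : ℝ) + k false =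
        -(total (below e false u) D - total (below e true u) D : ℤ) := by
      rw [show ((w : unitInterval) : ℝ) = u from rfl] at hsum
      exact_mod_cast (by rw [hsum]; ring : k true + k false =
        -(total (below e false u) D - total (below e true u) D))
    push_cast at hsum'
    refine ⟨l.1 e * (k false + total (below e false u) D), ?_, ?_⟩
    · filter_upwards [eventually_add_total_ramp D he (hk false)] with z hz
      simp only [sgn_false, Int.cast_one, one_mul] at hz
      rw [← hφu]
      exact hz
    · filter_upwards [eventually_add_total_ramp D he (hk true)] with z hz
      simp only [sgn_true, Int.cast_one, Int.cast_neg, neg_mul, one_mul, ← sub_eq_add_neg] at hz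
      rw [← hφu]
      refine Eq.trans hz ?_
      rw [show ((w : unitInterval) : ℝ) = u from rfl]
      linear_combination (l.1 e * z) * hsum'

theorem total_sum_single_vertex {M : Type*} [AddCommGroup M] (g : Model G → M)
    (κ : Fin G.m → ℤ) : total g (∑ v, Finsupp.single (.inl v) (κ v)) = ∑ v, κ v • g (.inl v) := by
  simp

/-- The function balances only over fibres of vertices, not at each vertex. The defect is a divisor
with image zero, hence principal, and subtracting it leaves a genuine potential. -/
theorem mem_principalDivisors_of_isPrincipal {l : G.Cone} {D : Model G →₀ ℤ}
    (hD : ∀ x ∈ D.support, IsNormal l x) (H : IsPrincipal (D.mapDomain (pt l))) :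
    D ∈ principalDivisors l := by
  classical
  obtain ⟨f, hf⟩ := H
  have hstar : ∀ v, ∃ M : VertexDirs l (pt l (.inl v)) → ℤ,
      (∀ i, ∀ᶠ y in 𝓝[>] (0 : ℝ), f (ray l i.1.1 i.1.2 (endCoord i.1.2) y) =
        f (pt l (.inl v)) + M i * y) ∧ D.mapDomain (pt l) (pt l (.inl v)) = -∑ i, M i := fun v => by
    obtain ⟨ε, hs⟩ := exists_isStar_vertex l v
    exact hs.hasOrderAt_iff.1 (hf _)
  choose M hM hsum using hstar
  -- Contracted edges get slope zero; the flow they ought to carry goes into the defect `κ`.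
  let s : Fin G.n → Bool → ℤ := fun e b =>
    if he : 0 < l.1 e then M (endpt e b) ⟨(e, b), he, rfl⟩ else 0
  have hs : ∀ e, 0 < l.1 e → ∀ b, ∀ᶠ y in 𝓝[>] (0 : ℝ), f (ray l e b (endCoord b) y) =
      f (pt l (.inl (endpt e b))) + s e b * y := fun e he b => by
    simp only [s, dif_pos he]
    exact hM (endpt e b) ⟨(e, b), he, rfl⟩
  have hMs : ∀ v i, M v i = s i.1.1 i.1.2 := fun v i => by
    obtain ⟨⟨e, b⟩, he, hp⟩ := i
    have := (affine_germ_unique (a := f (pt l (.inl v))) (b := M v ⟨(e, b), he, hp⟩)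
      (a' := f (pt l (.inl (endpt e b)))) (b' := s e b) (by
        filter_upwards [hM v ⟨(e, b), he, hp⟩, hs e he b] with y h1 h2
        rw [← h1, ← h2])).2
    exact_mod_cast this
  have hedge := fun e he => edge_slopes hD hf he (hs e he)
  let m : Fin G.n → ℤ := fun e => s e false
  let κ : Fin G.m → ℤ := fun v =>
    total (onVertex v) D - boundary (fun e => m e - total (onEdge e) D) m v
  have hκ : ∀ v, ∑ w, (if pt l (.inl w) = pt l (.inl v) then κ w else 0) = 0 := fun v => by
    have h1 : ∀ w, (if pt l (.inl w) = pt l (.inl v) then κ w else 0) =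
        (if pt l (.inl w) = pt l (.inl v) then total (onVertex w) D else 0) -
        if pt l (.inl w) = pt l (.inl v) then
          boundary (fun e => m e - total (onEdge e) D) m w else 0 := fun w => by
      split_ifs <;> simp [κ]
    simp only [h1]
    rw [Finset.sum_sub_distrib, ← mapDomain_pt_vertex hD,
      sum_boundary_eq _ fun e he => total_onEdge_of_eq_zero hD he, hsum, sub_neg_eq_add,
      neg_add_eq_zero]
    refine Finset.sum_congr rfl fun i _ => ?_
    rw [hMs]
    obtain ⟨⟨e, b⟩, he, hp⟩ := i
    cases b
    · simp [m]
    · simp [m, (hedge e he).2]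
  set K : Model G →₀ ℤ := ∑ v, Finsupp.single (.inl v) (κ v) with hK
  have hKmem : K ∈ principalDivisors l := by
    rw [← sub_zero K]
    refine sub_mem_of_mapDomain_eq ?_
    rw [hK, Finsupp.mapDomain_finsetSum, Finsupp.mapDomain_zero]
    simp only [Finsupp.mapDomain_single]
    ext p
    rw [Finsupp.finsetSum_apply, Finsupp.zero_apply]
    simp only [Finsupp.single_apply]
    by_cases hp : ∃ v, pt l (.inl v) = p
    · obtain ⟨v, rfl⟩ := hp
      exact hκ v
    · push Not at hp
      simp [hp]
  have hpot : IsPotential l (D - K) (fun v => f (pt l (.inl v))) m := by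
    refine ⟨fun e => ?_, fun v => ?_⟩
    · rw [map_sub, hK, total_sum_single_vertex]
      simp only [ramp, smul_zero, Finset.sum_const_zero, sub_zero]
      rcases (l.2.1 e).eq_or_lt with he | he
      · rw [← he, zero_mul, pt_src_eq_pt_tgt he.symm, sub_self]
      · exact (hedge e he).1
    · simp only [map_sub]
      simp only [hK, total_sum_single_vertex, onEdge, onVertex, smul_zero, Finset.sum_const_zero,
        sub_zero]
      simp [κ]
  have := add_mem (show D - K ∈ principalDivisors l from ⟨_, _, hpot⟩) hKmem
  rwa [sub_add_cancel] at this

theorem isPrincipal_mapDomain_pt_iff {l : G.Cone} {D : Model G →₀ ℤ} :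
    IsPrincipal (D.mapDomain (pt l)) ↔ D ∈ principalDivisors l := by
  obtain ⟨D', hD', h⟩ := exists_isNormal_mapDomain_eq l D
  have hsub := sub_mem_of_mapDomain_eq h
  rw [← h]
  refine ⟨fun H => ?_, fun H => ?_⟩
  · have := sub_mem (mem_principalDivisors_of_isPrincipal hD' H) hsub
    rwa [sub_sub_cancel] at this
  · have := add_mem hsub H
    rw [sub_add_cancel] at this
    obtain ⟨_, _, hp⟩ := this
    exact isPrincipal_of_isPotential hD' hp

/-! ### Semicontinuity -/

instance (l : G.Cone) : Nonempty (Realization l) := ⟨pt l (.inl ⟨0, G.nonempty⟩)⟩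

theorem exists_mapDomain_pt_eq {l : G.Cone} (D : Realization l →₀ ℤ) :
    ∃ D' : Model G →₀ ℤ, D'.mapDomain (pt l) = D :=
  Finsupp.mapDomain_surjective (pt_surjective l) D

theorem deg_eq_zero_of_isPrincipal {l : G.Cone} (D : Realization l →₀ ℤ) (hD : IsPrincipal D) :
    deg D = 0 := by
  obtain ⟨D, rfl⟩ := exists_mapDomain_pt_eq D
  rw [deg_mapDomain, deg_eq_zero_of_mem_principalDivisors (isPrincipal_mapDomain_pt_iff.1 hD)]

theorem isPrincipal_add {l : G.Cone} (D D' : Realization l →₀ ℤ) (hD : IsPrincipal D)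
    (hD' : IsPrincipal D') : IsPrincipal (D + D') := by
  obtain ⟨D, rfl⟩ := exists_mapDomain_pt_eq D
  obtain ⟨D', rfl⟩ := exists_mapDomain_pt_eq D'
  rw [← Finsupp.mapDomain_add]
  rw [isPrincipal_mapDomain_pt_iff] at *
  exact add_mem hD hD'

theorem mapDomain_pt_sub (l : G.Cone) (D D' : Model G →₀ ℤ) :
    (D - D').mapDomain (pt l) = D.mapDomain (pt l) - D'.mapDomain (pt l) :=
  map_sub (Finsupp.mapDomain.addMonoidHom (pt l)) D D'

theorem isPrincipal_neg {l : G.Cone} (D : Realization l →₀ ℤ) (hD : IsPrincipal D) :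
    IsPrincipal (-D) := by
  obtain ⟨D, rfl⟩ := exists_mapDomain_pt_eq D
  have h := mapDomain_pt_sub l 0 D
  rw [Finsupp.mapDomain_zero, zero_sub, zero_sub] at h
  rw [← h]
  rw [isPrincipal_mapDomain_pt_iff] at *
  exact neg_mem hD

theorem linEquiv_mapDomain_pt_iff {l : G.Cone} {D D' : Model G →₀ ℤ} :
    LinEquiv (D.mapDomain (pt l)) (D'.mapDomain (pt l)) ↔ D - D' ∈ principalDivisors l := by
  rw [LinEquiv, ← mapDomain_pt_sub, isPrincipal_mapDomain_pt_iff]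

theorem exists_ofTuple_pt {l : G.Cone} {N : ℕ} {D : Realization l →₀ ℤ} (hD : Effective D)
    (hN : deg D = N) : ∃ x : Fin N → Model G, (ofTuple x).mapDomain (pt l) = D := by
  obtain ⟨x, rfl⟩ := hD.exists_ofTuple hN
  choose y hy using fun j => pt_surjective l (x j)
  exact ⟨y, by rw [mapDomain_ofTuple]; simp only [hy]⟩

theorem weakTendsto_ofTuple {ι : Type*} {F : Filter ι} {N : ℕ} {x : ι → Fin N → Model G}
    {x₀ : Fin N → Model G} (h : Tendsto x F (𝓝 x₀)) :
    WeakTendsto (fun i => ofTuple (x i)) F (ofTuple x₀) := by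
  intro g hg
  simp only [ofTuple, map_sum, Finsupp.linearCombination_single, one_smul]
  exact tendsto_finsetSum _ fun j _ =>
    (hg.tendsto _).comp (((continuous_apply j).tendsto _).comp h)

theorem exists_tendsto_model {ι : Type*} (U : Ultrafilter ι) {N : ℕ} (x : ι → Fin N → Model G) :
    ∃ x₀, Tendsto x U (𝓝 x₀) := by
  obtain ⟨x₀, -, h⟩ := (isCompact_univ (X := Fin N → Model G)).ultrafilter_le_nhds (U.map x)
    (by simp)
  exact ⟨x₀, h⟩

/-- Two uses of compactness, for the divisor of large rank and for each of its representatives,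
followed by closedness of linear equivalence. -/
theorem mem_domination_brillNoetherLocus_of_tendsto {U : Ultrafilter G.Cone} {l₀ : G.Cone}
    (hU : (U : Filter G.Cone) ≤ 𝓝 l₀) {r d c : ℕ}
    (H : ∀ᶠ l in (U : Filter G.Cone),
      (c : ℤ) ∈ domination (brillNoetherLocus (Realization l) r d) r) :
    (c : ℤ) ∈ domination (brillNoetherLocus (Realization l₀) r d) r := by
  intro E hE hdeg
  -- Labels do not depend on the lengths, so `x` also defines a divisor on every nearby realization.
  obtain ⟨x, rfl⟩ := exists_ofTuple_pt (N := r + c) hE (by rw [hdeg]; push_cast; rfl)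
  -- The inequality is recorded because the subtraction in `Fin (d - (r + c))` is truncated.
  have H1 : ∀ᶠ l in (U : Filter G.Cone), r + c ≤ d ∧ ∃ y : Fin (d - (r + c)) → Model G,
      (r : ℤ) ≤ rank ((ofTuple x + ofTuple y).mapDomain (pt l)) := by
    filter_upwards [H] with l hl
    obtain ⟨D, ⟨hD, hr⟩, hDE⟩ := hl ((ofTuple x).mapDomain (pt l))
      (by rw [mapDomain_ofTuple]; exact effective_ofTuple _)
      (by rw [deg_mapDomain, deg_ofTuple]; push_cast; rfl)
    have h1 := hDE.deg_nonneg
    rw [deg_sub, deg_mapDomain, deg_ofTuple, hD] at h1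
    have hle : r + c ≤ d := by omega
    obtain ⟨y, hy⟩ := exists_ofTuple_pt (N := d - (r + c)) hDE
      (by rw [deg_sub, deg_mapDomain, deg_ofTuple, hD, Nat.cast_sub hle])
    refine ⟨hle, y, ?_⟩
    rwa [Finsupp.mapDomain_add, hy, add_sub_cancel]
  have hle : r + c ≤ d := H1.exists.choose_spec.1
  obtain ⟨y, hy⟩ := (H1.mono fun l h => h.2).choice
  obtain ⟨y₀, hy₀⟩ := exists_tendsto_model U y
  refine ⟨(ofTuple x + ofTuple y₀).mapDomain (pt l₀), ⟨?_, ?_⟩, ?_⟩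
  · rw [deg_mapDomain, deg_add, deg_ofTuple, deg_ofTuple]
    omega
  · rw [le_rank_iff deg_eq_zero_of_isPrincipal]
    intro E' hE' hdeg'
    obtain ⟨z, rfl⟩ := exists_ofTuple_pt (N := r) hE' (by rw [hdeg', zero_add])
    have H2 : ∀ᶠ l in (U : Filter G.Cone), ∃ t : Fin (d - r) → Model G,
        (ofTuple z + ofTuple t) - (ofTuple x + ofTuple (y l)) ∈ principalDivisors l := by
      filter_upwards [hy] with l hl
      obtain ⟨D', h1, h2⟩ := (le_rank_iff deg_eq_zero_of_isPrincipal _ _).1 hl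
        ((ofTuple z).mapDomain (pt l)) (by rw [mapDomain_ofTuple]; exact effective_ofTuple _)
        (by rw [deg_mapDomain, deg_ofTuple, zero_add])
      obtain ⟨t, ht⟩ := exists_ofTuple_pt (N := d - r) h2 (by
        have := deg_eq_zero_of_isPrincipal _ h1
        rw [deg_sub, deg_mapDomain, deg_add, deg_ofTuple, deg_ofTuple] at this
        rw [deg_sub, deg_mapDomain, deg_ofTuple]
        omega)
      refine ⟨t, ?_⟩
      rw [← linEquiv_mapDomain_pt_iff, Finsupp.mapDomain_add, ht, add_sub_cancel]
      exact h1
    obtain ⟨t, ht⟩ := H2.choice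
    obtain ⟨t₀, ht₀⟩ := exists_tendsto_model U t
    refine ⟨(ofTuple z + ofTuple t₀).mapDomain (pt l₀), ?_, ?_⟩
    · refine linEquiv_mapDomain_pt_iff.2 (mem_principalDivisors_of_tendsto U hU ?_ ht)
      intro g hg
      simp only [map_sub, map_add]
      exact (tendsto_const_nhds.add (weakTendsto_ofTuple ht₀ g hg)).sub
        (tendsto_const_nhds.add (weakTendsto_ofTuple hy₀ g hg))
    · rw [Finsupp.mapDomain_add, add_sub_cancel_left, mapDomain_ofTuple]
      exact effective_ofTuple _
  · rw [Finsupp.mapDomain_add, add_sub_cancel_left, mapDomain_ofTuple]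
    exact effective_ofTuple _

theorem isClosed_setOf_le_brillNoetherRank (r d : ℕ) (c : ℤ) :
    IsClosed {l : G.Cone | c ≤ brillNoetherRank (Realization l) r d} := by
  rcases lt_or_ge c 0 with hc | hc
  -- For negative `c` the condition is empty, as `w^r_d ≥ -1` always.
  · convert isClosed_univ
    refine Set.eq_univ_of_forall fun l => le_trans (by omega : c ≤ -1)
      (neg_one_le_brillNoetherRank deg_eq_zero_of_isPrincipal isPrincipal_add isPrincipal_neg r d)
  · lift c to ℕ using hc
    simp only [le_brillNoetherRank_iff]
    exact isClosed_iff_ultrafilter.2 fun l₀ U hU hS =>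
      mem_domination_brillNoetherLocus_of_tendsto hU hS

end Graph
end MetricGraph

/-! ### Descent from the cones to the moduli space -/

theorem mainTheorem2 (g k r d : ℕ) :
    UpperSemicontinuous (MetricGraph.moduliBrillNoetherRank g k r d) := by
  rw [upperSemicontinuous_iff_isClosed_preimage]
  intro c
  rw [← isQuotientMap_quotient_mk'.isClosed_preimage, isClosed_sigma_iff]
  exact fun G => MetricGraph.Graph.isClosed_setOf_le_brillNoetherRank r d c
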